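/- **Theorem.** Let $d\ge 1$ and let $S\in\{\tfrac12,1,\tfrac32,\dots\}$. For a finite set $\Lambda\subset\mathbb Z^d$ let $S_x^{(1)},S_x^{(2)},S_x^{(3)}$, $x\in\Lambda$, be the spin-$S$ operators on $\bigotimes_{x\in\Lambda}\mathbb C^{2S+1}$, and for $h\in\mathbb R$ let $$H_{\Lambda,h}=-\sum_{i=1}^3\sum_{x,y\in\Lambda}J^{(i)}_{x-y}S^{(i)}_xS^{(i)}_y-h\sum_{x\in\Lambda}S^{(3)}_x ,$$ where the couplings $J^{(i)}:\mathbb Z^d\to\mathbb R$ satisfy $J^{(i)}_{-x}=J^{(i)}_x$ and $\sum_{x\in\mathbb Z^d}|J^{(i)}_x|<\infty$ for $i=1,2,3$. For $0<\beta<\infty$ put $Z(\Lambda,\beta,h)=\operatorname{Tr}e^{-\beta H_{\Lambda,h}}$, $f_\Lambda(\beta,h)=-\frac1{\beta|\Lambda|}\log Z(\Lambda,\beta,h)$ and $\langle A\rangle_{\Lambda,\beta,h}=\operatorname{Tr}(A\,e^{-\beta H_{\Lambda,h}})/Z(\Lambda,\beta,h)$; for $\beta=\infty$ let $f_\Lambda(\infty,h)$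 and $\langle A\rangle_{\Lambda,\infty,h}$ be the limits of these as $\beta\to\infty$. A van Hove sequence is an increasing sequence of finite sets $\Lambda_k\subset\mathbb Z^d$ with $\bigcup_k\Lambda_k=\mathbb Z^d$ and $|\{x\in\Lambda_k:\operatorname{dist}(x,\Lambda_k^{\mathrm c})=1\}|/|\Lambda_k|\to0$. Let $0<\beta\le\infty$. Assume that $J^{(1)}_x=J^{(2)}_x$ for all $x\in\mathbb Z^d$, and that there is long-range order: for some van Hove sequence $(\Lambda_k)$ and some constant $c>0$ independent of $k$, $$\frac1{|\Lambda_k|^2}\sum_{x,y\in\Lambda_k}\langle S^{(3)}_xS^{(3)}_y\rangle_{\Lambda_k,\beta,0}\ \ge\ c\qquad\text{for all }k .$$ Then the infinite-volume free energy $f(\beta,h)$, that is, the function of $h\in\mathbb R$ with $f(\beta,h)=\lim_{k\to\infty}f_{\Lambda_k}(\beta,h)$ along every van Hove sequence $(\Lambda_k)$, exists, and it has one-sided derivatives in $h$ at $0$ with $$\frac{\partial}{\partial h}f(\beta,h)\Big|_{h=0-}\;>\;0\;>\;\frac{\partial}{\partial h}f(\beta,h)\Big|_{h=0+}.$$ 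-/

import Mathlib

open Filter Topology
open scoped ENNReal

namespace QuantumSpin

/-- The raising operator `S⁺` of one spin `S = (n - 1) / 2` on `ℂⁿ`. The basis vector with index
`k = 0, …, n - 1` is the eigenvector of the third spin operator with eigenvalue `m = S - k`, and
the entry `(k, k + 1)` is `√(S (S + 1) - m (m - 1)) = √((k + 1) (n - 1 - k))`. -/
noncomputable def raising (n : ℕ) : Matrix (Fin n) (Fin n) ℂ :=
  Matrix.of fun j k =>
    if j.val + 1 = k.val then
      ((Real.sqrt (((j.val : ℝ) + 1) * ((n : ℝ) - 1 - (j.val : ℝ))) : ℝ) : ℂ)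
    else 0

/-- The three spin operators of one spin `S = (n - 1) / 2` on `ℂⁿ`; the indices `0, 1, 2` stand for
the components `1, 2, 3`. For `n = 2` they are half the Pauli matrices. -/
noncomputable def spin (n : ℕ) : Fin 3 → Matrix (Fin n) (Fin n) ℂ :=
  ![(1 / 2 : ℂ) • (raising n + (raising n).conjTranspose),
    (-Complex.I / 2) • (raising n - (raising n).conjTranspose),
    Matrix.diagonal fun k : Fin n => (((n : ℝ) - 1) / 2 - (k.val : ℝ) : ℂ)]

/-- The operator `A ⊗ Id` that acts as `A` on the factor `x` of the tensor product of copies of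
`ℂⁿ` indexed by `ι`, as a matrix in the basis of classical configurations `ι → Fin n`. -/
def siteOp {ι : Type*} [Fintype ι] [DecidableEq ι] {n : ℕ} (x : ι)
    (A : Matrix (Fin n) (Fin n) ℂ) : Matrix (ι → Fin n) (ι → Fin n) ℂ :=
  Matrix.of fun σ τ => if ∀ y, y ≠ x → σ y = τ y then A (σ x) (τ x) else 0

/-- The spin operator `S_x⁽ⁱ⁾` on the state space of the finite domain `Λ ⊂ ℤᵈ`. -/
noncomputable def spinAt {d : ℕ} (n : ℕ) (Λ : Finset (Fin d → ℤ)) (i : Fin 3) (x : Λ) :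
    Matrix (Λ → Fin n) (Λ → Fin n) ℂ :=
  siteOp x (spin n i)

/-- The Hamiltonian
`H_{Λ,h} = - ∑ᵢ ∑_{x,y ∈ Λ} J⁽ⁱ⁾_{x-y} S_x⁽ⁱ⁾ S_y⁽ⁱ⁾ - h ∑_{x ∈ Λ} S_x⁽³⁾`. -/
noncomputable def hamiltonian {d : ℕ} (n : ℕ) (J : Fin 3 → (Fin d → ℤ) → ℝ)
    (Λ : Finset (Fin d → ℤ)) (h : ℝ) : Matrix (Λ → Fin n) (Λ → Fin n) ℂ :=
  -(∑ i : Fin 3, ∑ x : Λ, ∑ y : Λ,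
      (J i (x.val - y.val) : ℂ) • (spinAt n Λ i x * spinAt n Λ i y))
    - (h : ℂ) • ∑ x : Λ, spinAt n Λ 2 x

/-- The Gibbs operator `exp (-β H_{Λ,h})` at finite inverse temperature `β`. -/
noncomputable def gibbs {d : ℕ} (n : ℕ) (J : Fin 3 → (Fin d → ℤ) → ℝ)
    (Λ : Finset (Fin d → ℤ)) (β h : ℝ) : Matrix (Λ → Fin n) (Λ → Fin n) ℂ :=
  NormedSpace.exp (-((β : ℂ) • hamiltonian n J Λ h))

/-- The partition function `Z(Λ, β, h) = Tr exp (-β H_{Λ,h})`, at finite `β`. The trace is a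
positive real number, because the Hamiltonian is Hermitian. -/
noncomputable def partitionFunction {d : ℕ} (n : ℕ) (J : Fin 3 → (Fin d → ℤ) → ℝ)
    (Λ : Finset (Fin d → ℤ)) (β h : ℝ) : ℝ :=
  (gibbs n J Λ β h).trace.re

/-- The finite-volume free energy `-(β |Λ|)⁻¹ log Z(Λ, β, h)` at finite `β`. -/
noncomputable def freeEnergyReal {d : ℕ} (n : ℕ) (J : Fin 3 → (Fin d → ℤ) → ℝ)
    (Λ : Finset (Fin d → ℤ)) (β h : ℝ) : ℝ :=
  -(1 / (β * (Λ.card : ℝ))) * Real.log (partitionFunction n J Λ β h)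

/-- The finite-volume free energy `f_Λ(β, h)` for `0 < β ≤ ∞`; at `β = ∞` it is the limit
`β → ∞`, which exists. -/
noncomputable def freeEnergy {d : ℕ} (n : ℕ) (J : Fin 3 → (Fin d → ℤ) → ℝ)
    (Λ : Finset (Fin d → ℤ)) (β : ℝ≥0∞) (h : ℝ) : ℝ :=
  if β = ∞ then limUnder atTop (fun b : ℝ => freeEnergyReal n J Λ b h)
  else freeEnergyReal n J Λ β.toReal h

/-- The equilibrium state `⟨A⟩ = Tr (A exp (-β H_{Λ,h})) / Z(Λ, β, h)` at finite `β`. -/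
noncomputable def stateReal {d : ℕ} (n : ℕ) (J : Fin 3 → (Fin d → ℤ) → ℝ)
    (Λ : Finset (Fin d → ℤ)) (β h : ℝ) (A : Matrix (Λ → Fin n) (Λ → Fin n) ℂ) : ℂ :=
  (A * gibbs n J Λ β h).trace / (partitionFunction n J Λ β h : ℂ)

/-- The equilibrium state `⟨A⟩_{Λ,β,h}` for `0 < β ≤ ∞`; at `β = ∞` it is the limit `β → ∞`,
which exists. -/
noncomputable def state {d : ℕ} (n : ℕ) (J : Fin 3 → (Fin d → ℤ) → ℝ)
    (Λ : Finset (Fin d → ℤ)) (β : ℝ≥0∞) (h : ℝ) (A : Matrix (Λ → Fin n) (Λ → Fin n) ℂ) : ℂ :=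
  if β = ∞ then limUnder atTop (fun b : ℝ => stateReal n J Λ b h A)
  else stateReal n J Λ β.toReal h A

/-- The sites `x ∈ Λ` at distance one from the complement of `Λ`. -/
def innerBoundary {d : ℕ} (Λ : Finset (Fin d → ℤ)) : Set (Fin d → ℤ) :=
  {x | x ∈ Λ ∧ ∃ y, y ∉ Λ ∧ ∑ i, |x i - y i| = 1}

/-- Finite domains `Λ 0, Λ 1, …` tending to `ℤᵈ` in the sense of van Hove. -/
structure IsVanHove {d : ℕ} (Λ : ℕ → Finset (Fin d → ℤ)) : Prop where
  increasing : ∀ k, Λ k ⊆ Λ (k + 1)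
  invades : ∀ x, ∃ k, x ∈ Λ k
  boundary : Tendsto (fun k => ((innerBoundary (Λ k)).ncard : ℝ) / ((Λ k).card : ℝ))
    atTop (𝓝 0)

/-- Long-range order of the third spin component at `(β, 0)`: along some van Hove sequence,
`|Λ|⁻² ∑_{x,y ∈ Λ} ⟨S_x⁽³⁾ S_y⁽³⁾⟩_{Λ,β,0} ≥ c` with `c > 0` uniform in the volume. The correlations
are real numbers, because all the operators involved are Hermitian and the spin operators in the
product commute. -/
def LongRangeOrder {d : ℕ} (n : ℕ) (J : Fin 3 → (Fin d → ℤ) → ℝ) (β : ℝ≥0∞) : Prop :=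
  ∃ Λ : ℕ → Finset (Fin d → ℤ), IsVanHove Λ ∧ ∃ c : ℝ, 0 < c ∧ ∀ k,
    c ≤ 1 / ((Λ k).card : ℝ) ^ 2 *
      ∑ x : Λ k, ∑ y : Λ k,
        (state n J (Λ k) β 0 (spinAt n (Λ k) 2 x * spinAt n (Λ k) 2 y)).re

/-- `f` is the infinite-volume free energy `h ↦ f(β, h)`: the limit of the finite-volume free
energies along every van Hove sequence. There is at most one such function, because van Hove
sequences exist. -/
def IsInfiniteVolumeFreeEnergy {d : ℕ} (n : ℕ) (J : Fin 3 → (Fin d → ℤ) → ℝ) (β : ℝ≥0∞)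
    (f : ℝ → ℝ) : Prop :=
  ∀ Λ : ℕ → Finset (Fin d → ℤ), IsVanHove Λ →
    ∀ h : ℝ, Tendsto (fun k => freeEnergy n J (Λ k) β h) atTop (𝓝 (f h))

end QuantumSpin

/-! Write `p = -f`; the claim is that the convex function `p` has a genuine kink at `h = 0`.

Kink. As the first two couplings agree, the zero-field Hamiltonian commutes with the total third
spin `M`, which is diagonal in the configuration basis. Hence `Z(h) = ∑ w(σ) exp (β h M(σ))` with
`w(σ) > 0` the diagonal entries of `exp (-β H₀)` (`trace_exp_eq_sum_weight`), and `log Z` is convex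
in `h`. The rotation by `π` about the first axis preserves `w` and reverses `M`, so `exp (β h M)`
may be replaced by `cosh (β h M) ≥ ½ exp (β |h| |M|)`. Jensen's inequality and `|M| ≤ n |Λ|` give
`Z(h) ≥ ½ Z(0) exp (β |h| ⟨M²⟩ / (n |Λ|))` (`half_exp_le_sum_exp`). Long-range order makes the
exponent proportional to the volume, against which `log 2` is lost. In the limit `p(h) ≥ p(0) + a
|h|` with `a > 0`, and convexity yields the two one-sided derivatives.

Existence of the limit. By Peierls' inequality, `log Tr exp` is 1-Lipschitz in the operator norm.
Deleting the couplings between two regions therefore changes `β⁻¹ log Z` by at most their total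
strength, uniformly in `β` and `h`. Such an almost additive function has a limit per site
(`AlmostAdditive.exists_limit`): tile by large cubes; summability makes the couplings across cube
faces negligible, and the van Hove condition does the same for the incomplete cubes.

Zero temperature. The finite-volume inequalities hold uniformly for inverse temperatures `b ≥ b₀ >
0`, so they survive the limit `b → ∞`, which is taken before the volume grows. -/

namespace QuantumSpin

/-! ### Tiling finite domains by cubes -/

section Boxes

variable {d : ℕ}

/-- The cube of side `L` with index `a` in the tiling of `ℤᵈ` by cubes. -/
noncomputable def cube (L : ℕ) (a : Fin d → ℤ) : Finset (Fin d → ℤ) :=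
  Fintype.piFinset fun i => Finset.Ico (a i * L) (a i * L + L)

/-- The index of the cube of side `L` that contains a site. -/
def cubeIndex (L : ℕ) (x : Fin d → ℤ) : Fin d → ℤ := fun i => x i / L

lemma mem_cube {L : ℕ} {a x : Fin d → ℤ} :
    x ∈ cube L a ↔ ∀ i, a i * L ≤ x i ∧ x i < a i * L + L := by
  simp [cube, Fintype.mem_piFinset]

lemma mem_cube_iff {L : ℕ} (hL : 0 < L) {a x : Fin d → ℤ} :
    x ∈ cube L a ↔ cubeIndex L x = a := by
  have hL' : (0 : ℤ) < L := by exact_mod_cast hL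
  rw [mem_cube, funext_iff]
  refine forall_congr' fun i => ?_
  rw [cubeIndex, Int.ediv_eq_iff_of_pos hL']

lemma card_cube (L : ℕ) (a : Fin d → ℤ) : (cube L a).card = L ^ d := by
  simp [cube, Fintype.card_piFinset]

lemma cube_disjoint {L : ℕ} (hL : 0 < L) {a b : Fin d → ℤ} (hab : a ≠ b) :
    Disjoint (cube L a) (cube L b) := by
  rw [Finset.disjoint_left]
  intro x hx hy
  rw [mem_cube_iff hL] at hx hy
  exact hab (hx.symm.trans hy)

lemma cube_eq_map (L : ℕ) (a : Fin d → ℤ) :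
    cube L a = (cube L 0).map (addRightEmbedding fun i => a i * (L : ℤ)) := by
  ext x
  simp only [Finset.mem_map, mem_cube, addRightEmbedding_apply, Pi.zero_apply, zero_mul, zero_add]
  constructor
  · intro h
    refine ⟨x - fun i => a i * (L : ℤ), fun i => ?_, by simp⟩
    have := h i
    simp only [Pi.sub_apply]
    omega
  · rintro ⟨y, hy, rfl⟩ i
    have := hy i
    simp only [Pi.add_apply]
    omega

/-- Walk from `x` towards `y` by unit steps in one coordinate at a time. The walk stays in the cube,
and the last site before it leaves `Λ` lies on the inner boundary. The induction is on a bound for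
the ℓ¹ distance. -/
lemma exists_innerBoundary_of_mem_cube {L : ℕ} {a : Fin d → ℤ} {Λ : Finset (Fin d → ℤ)} :
    ∀ (m : ℕ) (x y : Fin d → ℤ), x ∈ Λ → y ∉ Λ → x ∈ cube L a → y ∈ cube L a →
      ∑ i, (x i - y i).natAbs ≤ m → ∃ p ∈ innerBoundary Λ, p ∈ cube L a := by
  intro m
  induction m with
  | zero =>
    intro x y hx hy _ _ hm
    exfalso
    have : x = y := by
      funext i
      have h0 := (Finset.sum_eq_zero_iff.mp (Nat.le_zero.mp hm)) i (Finset.mem_univ i)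
      omega
    exact hy (this ▸ hx)
  | succ m ih =>
    intro x y hx hy hxa hya hm
    have hne : x ≠ y := fun h => hy (h ▸ hx)
    obtain ⟨i, hi⟩ := Function.ne_iff.mp hne
    set s : ℤ := (y i - x i).sign with hs
    set z : Fin d → ℤ := Function.update x i (x i + s) with hz
    have hs1 : s.natAbs = 1 := by
      rw [hs, Int.natAbs_sign_of_ne_zero (by omega)]
    have hcase : (s = 1 ∧ x i < y i) ∨ (s = -1 ∧ y i < x i) := by
      rcases lt_or_gt_of_ne hi with h | h
      · left; exact ⟨Int.sign_eq_one_of_pos (by omega), h⟩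
      · right; exact ⟨Int.sign_eq_neg_one_of_neg (by omega), h⟩
    have hza : z ∈ cube L a := by
      rw [mem_cube] at *
      intro j
      by_cases hj : j = i
      · subst hj
        have h1 := hxa j
        have h2 := hya j
        simp only [hz, Function.update_self]
        omega
      · simp only [hz, Function.update_of_ne hj]
        exact hxa j
    by_cases hzΛ : z ∈ Λ
    · refine ih z y hzΛ hy hza hya ?_
      have hlt : ∑ j, (z j - y j).natAbs < ∑ j, (x j - y j).natAbs := by
        refine Finset.sum_lt_sum (fun j _ => ?_) ⟨i, Finset.mem_univ i, ?_⟩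
        · by_cases hj : j = i
          · subst hj
            simp only [hz, Function.update_self]
            omega
          · simp [hz, Function.update_of_ne hj]
        · simp only [hz, Function.update_self]
          omega
      omega
    · refine ⟨x, ⟨hx, z, hzΛ, ?_⟩, hxa⟩
      rw [Finset.sum_eq_single i]
      · simp only [hz, Function.update_self]
        rw [Int.abs_eq_natAbs]
        omega
      · intro j _ hj
        simp [hz, Function.update_of_ne hj]
      · simp

lemma innerBoundary_finite (Λ : Finset (Fin d → ℤ)) : (innerBoundary Λ).Finite :=
  Λ.finite_toSet.subset fun _ hx => hx.1

/-- The sites of `Λ` whose cube is not contained in `Λ`. -/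
noncomputable def cubeRest (L : ℕ) (Λ : Finset (Fin d → ℤ)) : Finset (Fin d → ℤ) :=
  Λ.filter fun x => ¬ cube L (cubeIndex L x) ⊆ Λ

/-- The indices of the cubes contained in `Λ`. -/
noncomputable def cubesInside (L : ℕ) (Λ : Finset (Fin d → ℤ)) : Finset (Fin d → ℤ) :=
  (Λ.image (cubeIndex L)).filter fun a => cube L a ⊆ Λ

/-- A cube that meets `Λ` without being contained in it has an inner boundary site, so the cubes
around the boundary sites cover the rest. -/
lemma card_cubeRest_le {L : ℕ} (hL : 0 < L) (Λ : Finset (Fin d → ℤ)) :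
    (cubeRest L Λ).card ≤ (innerBoundary Λ).ncard * L ^ d := by
  classical
  have hsub : cubeRest L Λ ⊆
      (innerBoundary_finite Λ).toFinset.biUnion fun p => cube L (cubeIndex L p) := by
    intro x hx
    obtain ⟨hxΛ, hx⟩ := Finset.mem_filter.mp hx
    obtain ⟨y, hy, hyΛ⟩ := Finset.not_subset.mp hx
    have hxc : x ∈ cube L (cubeIndex L x) := (mem_cube_iff hL).mpr rfl
    obtain ⟨p, hp, hpc⟩ := exists_innerBoundary_of_mem_cube _ x y hxΛ hyΛ hxc hy le_rfl
    rw [Finset.mem_biUnion]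
    refine ⟨p, by simpa using hp, ?_⟩
    rw [(mem_cube_iff hL).mp hpc]
    exact hxc
  refine (Finset.card_le_card hsub).trans (Finset.card_biUnion_le.trans ?_)
  simp [card_cube, Set.ncard_eq_toFinset_card _ (innerBoundary_finite Λ)]

lemma cubes_union_rest {L : ℕ} (hL : 0 < L) (Λ : Finset (Fin d → ℤ)) :
    cubeRest L Λ ∪ (cubesInside L Λ).biUnion (cube L) = Λ := by
  ext x
  simp only [Finset.mem_union, Finset.mem_biUnion, cubeRest, cubesInside, Finset.mem_filter,
    Finset.mem_image, mem_cube_iff hL]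
  constructor
  · rintro (h | ⟨a, ⟨-, h⟩, rfl⟩)
    · exact h.1
    · exact h ((mem_cube_iff hL).mpr rfl)
  · intro hx
    by_cases h : cube L (cubeIndex L x) ⊆ Λ
    · exact Or.inr ⟨_, ⟨⟨x, hx, rfl⟩, h⟩, rfl⟩
    · exact Or.inl ⟨hx, h⟩

lemma cubes_disjoint_rest {L : ℕ} (hL : 0 < L) (Λ : Finset (Fin d → ℤ)) :
    Disjoint (cubeRest L Λ) ((cubesInside L Λ).biUnion (cube L)) := by
  rw [Finset.disjoint_left]
  intro x hx hx'
  obtain ⟨a, ha, hxa⟩ := Finset.mem_biUnion.mp hx'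
  rw [mem_cube_iff hL] at hxa
  subst hxa
  exact (Finset.mem_filter.mp hx).2 (Finset.mem_filter.mp ha).2

lemma card_eq_cubes {L : ℕ} (hL : 0 < L) (Λ : Finset (Fin d → ℤ)) :
    Λ.card = (cubeRest L Λ).card + (cubesInside L Λ).card * L ^ d := by
  conv_lhs => rw [← cubes_union_rest hL Λ]
  rw [Finset.card_union_of_disjoint (cubes_disjoint_rest hL Λ), Finset.card_biUnion]
  · simp [card_cube]
  · intro a _ b _ hab
    exact cube_disjoint hL hab

end Boxes

/-! ### Thermodynamic limit of almost additive functions -/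

section AlmostAdditive

variable {d : ℕ}

/-- The total strength of the couplings between `B` and its complement. -/
noncomputable def boundaryEnergy (K : (Fin d → ℤ) → ℝ) (B : Finset (Fin d → ℤ)) : ℝ :=
  ∑ x ∈ B, ∑' y, if y ∈ B then 0 else K (x - y)

/-- A translation invariant function of finite domains that is additive up to the pair
couplings `K`. -/
structure AlmostAdditive (K : (Fin d → ℤ) → ℝ) (P : Finset (Fin d → ℤ) → ℝ) : Prop where
  union : ∀ A B, Disjoint A B → |P (A ∪ B) - P A - P B| ≤ ∑ x ∈ A, ∑ y ∈ B, K (x - y)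
  translate : ∀ A v, P (A.map (addRightEmbedding v)) = P A

variable {K : (Fin d → ℤ) → ℝ} (hK0 : ∀ x, 0 ≤ K x) (hK : Summable K)

include hK in
lemma summable_sub (x : Fin d → ℤ) : Summable fun y => K (x - y) :=
  (Equiv.subLeft x).summable_iff.mpr hK

lemma tsum_sub (x : Fin d → ℤ) : ∑' y, K (x - y) = ∑' z, K z :=
  (Equiv.subLeft x).tsum_eq K

include hK0 hK in
lemma summable_outside (x : Fin d → ℤ) (B : Finset (Fin d → ℤ)) :
    Summable fun y => if y ∈ B then 0 else K (x - y) := by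
  refine Summable.of_nonneg_of_le (fun y => ?_) (fun y => ?_) (summable_sub hK x)
  · split_ifs
    exacts [le_rfl, hK0 _]
  · split_ifs
    exacts [hK0 _, le_rfl]

include hK0 hK in
lemma tsum_outside_le (x : Fin d → ℤ) (B : Finset (Fin d → ℤ)) :
    (∑' y, if y ∈ B then 0 else K (x - y)) ≤ ∑' z, K z := by
  rw [← tsum_sub (K := K) x]
  refine (summable_outside hK0 hK x B).tsum_le_tsum (fun y => ?_) (summable_sub hK x)
  split_ifs
  exacts [hK0 _, le_rfl]

include hK0 hK in
lemma sum_cross_le_boundaryEnergy {A B : Finset (Fin d → ℤ)} (h : Disjoint A B) :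
    ∑ x ∈ A, ∑ y ∈ B, K (x - y) ≤ boundaryEnergy K A := by
  refine Finset.sum_le_sum fun x _ => ?_
  calc ∑ y ∈ B, K (x - y) = ∑ y ∈ B, if y ∈ A then 0 else K (x - y) := by
        refine Finset.sum_congr rfl fun y hy => ?_
        rw [if_neg (Finset.disjoint_right.mp h hy)]
    _ ≤ _ := by
        refine (summable_outside hK0 hK x A).sum_le_tsum _ fun y _ => ?_
        split_ifs
        exacts [le_rfl, hK0 _]

include hK0 hK in
lemma boundaryEnergy_le (A : Finset (Fin d → ℤ)) :
    boundaryEnergy K A ≤ A.card * ∑' z, K z := by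
  rw [← nsmul_eq_mul]
  exact Finset.sum_le_card_nsmul _ _ _ fun x _ => tsum_outside_le hK0 hK x A

lemma boundaryEnergy_map (A : Finset (Fin d → ℤ)) (v : Fin d → ℤ) :
    boundaryEnergy K (A.map (addRightEmbedding v)) = boundaryEnergy K A := by
  unfold boundaryEnergy
  rw [Finset.sum_map]
  refine Finset.sum_congr rfl fun x _ => ?_
  rw [← (Equiv.addRight v).tsum_eq]
  refine tsum_congr fun y => ?_
  simp

namespace AlmostAdditive

variable {P : Finset (Fin d → ℤ) → ℝ} (hP : AlmostAdditive K P)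

include hP in
lemma empty : P ∅ = 0 := by
  simpa using hP.union ∅ ∅ (by simp)

include hP hK0 hK in
-- Splitting off one block at a time costs at most the boundary energy of that block, however large
-- the remainder is.
lemma abs_biUnion_sub_sum_le {α : Type*} [DecidableEq α] (s : Finset α)
    (B : α → Finset (Fin d → ℤ)) (hB : ∀ a b, a ≠ b → Disjoint (B a) (B b)) :
    |P (s.biUnion B) - ∑ a ∈ s, P (B a)| ≤ ∑ a ∈ s, boundaryEnergy K (B a) := by
  induction s using Finset.induction_on with
  | empty => simp [hP.empty]
  | insert a s ha ih =>
    have hd : Disjoint (B a) (s.biUnion B) := by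
      rw [Finset.disjoint_biUnion_right]
      intro b hb
      exact hB a b fun h => ha (h ▸ hb)
    have h1 := (hP.union _ _ hd).trans (sum_cross_le_boundaryEnergy hK0 hK hd)
    rw [Finset.biUnion_insert, Finset.sum_insert ha, Finset.sum_insert ha]
    rw [abs_le] at *
    constructor <;> linarith [h1.1, h1.2, ih.1, ih.2]

include hP hK0 hK in
lemma abs_le_card (A : Finset (Fin d → ℤ)) :
    |P A| ≤ A.card * (|P {0}| + ∑' z, K z) := by
  classical
  have h1 := abs_biUnion_sub_sum_le hK0 hK hP A (fun x => {x}) (by simp)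
  have h2 : ∀ x, P {x} = P {0} := fun x => by
    rw [← hP.translate {0} x]; simp
  have h3 : ∑ x ∈ A, boundaryEnergy K {x} ≤ A.card * ∑' z, K z := by
    rw [← nsmul_eq_mul]
    refine Finset.sum_le_card_nsmul _ _ _ fun x _ => ?_
    simpa using boundaryEnergy_le hK0 hK {x}
  rw [Finset.biUnion_singleton_eq_self] at h1
  simp only [h2, Finset.sum_const, nsmul_eq_mul] at h1
  have h4 : |P A| ≤ |P A - A.card * P {0}| + |A.card * P {0}| := by
    simpa using abs_add_le (P A - A.card * P {0}) (A.card * P {0})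
  rw [abs_mul, Nat.abs_cast] at h4
  rw [mul_add]
  linarith

include hP hK0 hK in
-- The error has a part from incomplete cubes, which vanishes along van Hove sequences for fixed
-- `L`, and a part from the faces of complete cubes, which is small for large `L` uniformly in `Λ`.
lemma abs_sub_cube_le {L : ℕ} (hL : 0 < L) (Λ : Finset (Fin d → ℤ)) (hΛ : Λ.Nonempty) :
    |P Λ / Λ.card - P (cube L 0) / (L : ℝ) ^ d| ≤
      2 * (L : ℝ) ^ d * (|P {0}| + ∑' z, K z + ∑' z, K z) *
        ((innerBoundary Λ).ncard / (Λ.card : ℝ))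
      + boundaryEnergy K (cube L 0) / (L : ℝ) ^ d := by
  classical
  have hS0 : 0 ≤ ∑' z, K z := tsum_nonneg hK0
  set S := ∑' z, K z
  set C := |P {0}| + S
  set R := cubeRest L Λ
  set G := cubesInside L Λ
  have hN : (0 : ℝ) < Λ.card := by exact_mod_cast hΛ.card_pos
  have hM : (0 : ℝ) < (L : ℝ) ^ d := by positivity
  have hd := cubes_disjoint_rest hL Λ
  have h1 := (hP.union _ _ hd).trans ((sum_cross_le_boundaryEnergy hK0 hK hd).trans
    (boundaryEnergy_le hK0 hK _))
  rw [cubes_union_rest hL] at h1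
  have h2 := abs_biUnion_sub_sum_le hK0 hK hP G (cube L) fun a b hab => cube_disjoint hL hab
  have h3 : ∀ a, P (cube L a) = P (cube L 0) := fun a => by rw [cube_eq_map, hP.translate]
  have h4 : ∀ a : Fin d → ℤ, boundaryEnergy K (cube L a) = boundaryEnergy K (cube L 0) :=
    fun a => by rw [cube_eq_map, boundaryEnergy_map]
  simp only [h3, h4, Finset.sum_const, nsmul_eq_mul] at h2
  have h5 := abs_le_card hK0 hK hP R
  have h6 := abs_le_card hK0 hK hP (cube L 0)
  rw [card_cube, Nat.cast_pow] at h6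
  have hb0 : 0 ≤ boundaryEnergy K (cube L 0) :=
    Finset.sum_nonneg fun x _ => tsum_nonneg fun y => by split_ifs; exacts [le_rfl, hK0 _]
  have hcard : (Λ.card : ℝ) = R.card + G.card * (L : ℝ) ^ d := by
    exact_mod_cast card_eq_cubes hL Λ
  have hRle : (R.card : ℝ) ≤ (innerBoundary Λ).ncard * (L : ℝ) ^ d := by
    exact_mod_cast card_cubeRest_le hL Λ
  have hR0 : (0 : ℝ) ≤ R.card := Nat.cast_nonneg _
  have hG0 : (0 : ℝ) ≤ G.card := Nat.cast_nonneg _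
  set p := P (cube L 0) / (L : ℝ) ^ d with hp
  have hp' : P (cube L 0) = p * (L : ℝ) ^ d := by rw [hp]; field_simp
  have hpC : |p| ≤ C := by
    rw [hp, abs_div, abs_of_pos hM, div_le_iff₀ hM]
    linarith
  set b := boundaryEnergy K (cube L 0) / (L : ℝ) ^ d with hb
  have hb' : boundaryEnergy K (cube L 0) = b * (L : ℝ) ^ d := by rw [hb]; field_simp
  have hbn : 0 ≤ b := by positivity
  have hpR : |R.card * p| ≤ R.card * C := by
    rw [abs_mul, Nat.abs_cast]
    exact mul_le_mul_of_nonneg_left hpC hR0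
  have hGb : G.card * (b * (L : ℝ) ^ d) ≤ b * Λ.card := by
    rw [hcard]
    nlinarith [mul_nonneg hR0 hbn]
  have hmain : |P Λ - Λ.card * p| ≤ R.card * (2 * (C + S)) + b * Λ.card := by
    rw [hp'] at h2
    rw [hb'] at h2
    -- The four terms are at most `R.card * S` (couplings to the rest), `R.card * C`, the boundary
    -- energies of the cubes, and `R.card * C`.
    have e : P Λ - Λ.card * p = (P Λ - P R - P (G.biUnion (cube L))) + P R
        + (P (G.biUnion (cube L)) - G.card * (p * (L : ℝ) ^ d)) - R.card * p := by
      rw [hcard]; ring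
    have hRS : 0 ≤ R.card * S := mul_nonneg hR0 hS0
    rw [abs_le] at *
    rw [e]
    constructor <;> linarith [h1.1, h1.2, h2.1, h2.2, h5.1, h5.2, hpR.1, hpR.2]
  have hCS : 0 ≤ C + S := by positivity
  have e2 : P Λ / Λ.card - p = (P Λ - Λ.card * p) / Λ.card := by
    rw [sub_div, mul_div_cancel_left₀ _ hN.ne']
  rw [e2, abs_div, Nat.abs_cast, div_le_iff₀ hN]
  calc _ ≤ R.card * (2 * (C + S)) + b * Λ.card := hmain
    _ ≤ ((innerBoundary Λ).ncard * (L : ℝ) ^ d) * (2 * (C + S)) + b * Λ.card := by gcongr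
    _ = _ := by
        have e3 := div_mul_cancel₀ ((innerBoundary Λ).ncard : ℝ) hN.ne'
        linear_combination (-(2 * (L : ℝ) ^ d * (C + S))) * e3

end AlmostAdditive

include hK0 hK in
-- Up to `ε / 2` the couplings have a finite range `r`. Sites deeper than `r` in the cube feel only
-- this tail outside it, and the fraction `1 - (1 - 2r/L)^d` of other sites tends to zero.
lemma tendsto_boundaryEnergy_cube :
    Tendsto (fun L : ℕ => boundaryEnergy K (cube (d := d) L 0) / (L : ℝ) ^ d) atTop (𝓝 0) := by
  classical
  set S := ∑' z, K z
  have hS0 : 0 ≤ S := tsum_nonneg hK0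
  rw [Metric.tendsto_atTop]
  intro ε hε
  obtain ⟨T, hT⟩ : ∃ T : Finset (Fin d → ℤ), S - ∑ z ∈ T, K z < ε / 2 := by
    have h := (hK.hasSum.eventually (lt_mem_nhds (show S - ε / 2 < S by linarith))).exists
    obtain ⟨T, hT⟩ := h
    exact ⟨T, by linarith⟩
  obtain ⟨r, hr⟩ : ∃ r : ℕ, ∀ z ∈ T, ∀ i, |z i| ≤ r := by
    refine ⟨∑ z ∈ T, ∑ i, (z i).natAbs, fun z hz i => ?_⟩
    rw [Int.abs_eq_natAbs]
    exact_mod_cast (Finset.single_le_sum (f := fun i => (z i).natAbs) (fun _ _ => Nat.zero_le _)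
      (Finset.mem_univ i)).trans
      (Finset.single_le_sum (f := fun z : Fin d → ℤ => ∑ i, (z i).natAbs)
        (fun _ _ => Nat.zero_le _) hz)
  have hlim : Tendsto (fun L : ℕ => (1 - (1 - 2 * (r : ℝ) * (L : ℝ)⁻¹) ^ d) * S) atTop (𝓝 0) := by
    have h := tendsto_inv_atTop_zero.comp (tendsto_natCast_atTop_atTop (R := ℝ))
    have h2 := (((h.const_mul (2 * (r : ℝ))).const_sub 1).pow d).const_sub 1 |>.mul_const S
    simpa using h2
  obtain ⟨L0, hL0⟩ := (hlim.eventually (gt_mem_nhds (half_pos hε))).exists_forall_of_atTop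
  refine ⟨max L0 (2 * r + 1), fun L hL => ?_⟩
  have hL1 : L0 ≤ L := le_trans (le_max_left _ _) hL
  have hL2 : 2 * r + 1 ≤ L := le_trans (le_max_right _ _) hL
  have hLpos : (0 : ℝ) < L := by exact_mod_cast (by omega : 0 < L)
  have hM : (0 : ℝ) < (L : ℝ) ^ d := by positivity
  have hb0 : 0 ≤ boundaryEnergy K (cube (d := d) L 0) :=
    Finset.sum_nonneg fun x _ => tsum_nonneg fun y => by split_ifs; exacts [le_rfl, hK0 _]
  rw [Real.dist_eq, sub_zero, abs_of_nonneg (by positivity), div_lt_iff₀ hM]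
  set I : Finset (Fin d → ℤ) := Fintype.piFinset fun _ => Finset.Ico (r : ℤ) (L - r)
  have hI : I ⊆ cube L 0 := by
    intro x hx
    rw [mem_cube]
    intro i
    have := Finset.mem_Ico.mp (Fintype.mem_piFinset.mp hx i)
    simp only [Pi.zero_apply]
    omega
  have hIc : (I.card : ℝ) = ((L : ℝ) - 2 * r) ^ d := by
    have : I.card = (L - 2 * r) ^ d := by
      simp only [I, Fintype.card_piFinset, Int.card_Ico, Finset.prod_const, Finset.card_univ,
        Fintype.card_fin]
      congr 1
      omega
    rw [this, Nat.cast_pow, Nat.cast_sub (by omega)]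
    push_cast
    rfl
  have hin : ∀ x ∈ I, (∑' y, if y ∈ cube L 0 then 0 else K (x - y)) ≤ ε / 2 := by
    intro x hx
    have hs := summable_outside hK0 hK x (cube L 0)
    -- For `x` in the core, the sites `x - z` with `z ∈ T` all lie in the cube, so the two sums run
    -- over disjoint sets of sites.
    have h1 : (∑ z ∈ T, K z) + (∑' y, if y ∈ cube L 0 then 0 else K (x - y)) ≤ S := by
      have e : ∑ z ∈ T, K z = ∑ y ∈ T.map (Equiv.subLeft x).toEmbedding, K (x - y) := by
        simp [Finset.sum_map]
      have e2 : ∑ y ∈ T.map (Equiv.subLeft x).toEmbedding, K (x - y) =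
          ∑' y, if y ∈ T.map (Equiv.subLeft x).toEmbedding then K (x - y) else 0 := by
        rw [tsum_eq_sum (s := T.map (Equiv.subLeft x).toEmbedding)]
        · refine Finset.sum_congr rfl fun y hy => ?_
          rw [if_pos hy]
        · intro y hy
          rw [if_neg hy]
      have hSx : S = ∑' y, K (x - y) := (tsum_sub x).symm
      rw [e, e2, ← Summable.tsum_add ?_ hs, hSx]
      · refine Summable.tsum_le_tsum (fun y => ?_) (Summable.add ?_ hs) (summable_sub hK x)
        · by_cases hy : y ∈ T.map (Equiv.subLeft x).toEmbedding
          · have : y ∈ cube L 0 := by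
              obtain ⟨z, hz, rfl⟩ := Finset.mem_map.mp hy
              rw [mem_cube]
              intro i
              have h2 := hr z hz i
              have h3 := Finset.mem_Ico.mp (Fintype.mem_piFinset.mp hx i)
              rw [abs_le] at h2
              simp only [Equiv.coe_toEmbedding, Equiv.subLeft_apply, Pi.sub_apply, Pi.zero_apply]
              omega
            rw [if_pos hy, if_pos this, add_zero]
          · rw [if_neg hy, zero_add]
            split_ifs
            exacts [hK0 _, le_rfl]
        · exact summable_of_ne_finset_zero (s := T.map (Equiv.subLeft x).toEmbedding)
            fun y hy => if_neg hy
      · exact summable_of_ne_finset_zero (s := T.map (Equiv.subLeft x).toEmbedding)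
          fun y hy => if_neg hy
    linarith
  have hsplit : boundaryEnergy K (cube (d := d) L 0) ≤
      I.card * (ε / 2) + ((cube (d := d) L 0) \ I).card * S := by
    unfold boundaryEnergy
    rw [← Finset.sum_sdiff hI, add_comm]
    refine add_le_add ?_ ?_
    · rw [← nsmul_eq_mul]
      exact Finset.sum_le_card_nsmul _ _ _ hin
    · rw [← nsmul_eq_mul]
      exact Finset.sum_le_card_nsmul _ _ _ fun x _ => tsum_outside_le hK0 hK x _
  have hcs : (((cube (d := d) L 0) \ I).card : ℝ) = (L : ℝ) ^ d - ((L : ℝ) - 2 * r) ^ d := by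
    rw [Finset.card_sdiff_of_subset hI, Nat.cast_sub (Finset.card_le_card hI), hIc, card_cube,
      Nat.cast_pow]
  have hfin := hL0 L hL1
  have e3 : (1 - (1 - 2 * (r : ℝ) * (L : ℝ)⁻¹) ^ d) * S * (L : ℝ) ^ d =
      ((L : ℝ) ^ d - ((L : ℝ) - 2 * r) ^ d) * S := by
    have : ((L : ℝ) - 2 * r) ^ d = (1 - 2 * (r : ℝ) * (L : ℝ)⁻¹) ^ d * (L : ℝ) ^ d := by
      rw [← mul_pow]
      congr 1
      field_simp
    rw [this]; ring
  have h7 : (I.card : ℝ) ≤ (L : ℝ) ^ d := by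
    have := Finset.card_le_card hI
    rw [card_cube] at this
    exact_mod_cast this
  calc _ ≤ I.card * (ε / 2) + ((cube (d := d) L 0) \ I).card * S := hsplit
    _ ≤ (L : ℝ) ^ d * (ε / 2) + (1 - (1 - 2 * (r : ℝ) * (L : ℝ)⁻¹) ^ d) * S * (L : ℝ) ^ d := by
        rw [hcs, e3]
        gcongr
    _ < (L : ℝ) ^ d * (ε / 2) + ε / 2 * (L : ℝ) ^ d := by gcongr
    _ = ε * (L : ℝ) ^ d := by ring

lemma IsVanHove.monotone {Λ : ℕ → Finset (Fin d → ℤ)} (h : IsVanHove Λ) : Monotone Λ :=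
  monotone_nat_of_le_succ h.increasing

lemma IsVanHove.eventually_nonempty {Λ : ℕ → Finset (Fin d → ℤ)} (h : IsVanHove Λ) :
    ∀ᶠ k in atTop, (Λ k).Nonempty := by
  obtain ⟨k, hk⟩ := h.invades 0
  filter_upwards [eventually_ge_atTop k] with m hm
  exact ⟨0, h.monotone hm hk⟩

lemma IsVanHove.tendsto_card (hd : 1 ≤ d) {Λ : ℕ → Finset (Fin d → ℤ)} (h : IsVanHove Λ) :
    Tendsto (fun k => ((Λ k).card : ℝ)) atTop atTop := by
  -- For `d = 0` the lattice is a single point and the volumes stay bounded.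
  have : Nonempty (Fin d) := ⟨⟨0, hd⟩⟩
  refine tendsto_natCast_atTop_atTop.comp ?_
  rw [tendsto_atTop]
  intro m
  obtain ⟨T, hT⟩ := Infinite.exists_subset_card_eq (Fin d → ℤ) m
  have : ∀ᶠ k in atTop, ∀ x ∈ T, x ∈ Λ k := by
    rw [Filter.eventually_all_finset]
    intro x _
    obtain ⟨k, hk⟩ := h.invades x
    filter_upwards [eventually_ge_atTop k] with m hm
    exact h.monotone hm hk
  filter_upwards [this] with k hk
  rw [← hT]
  exact Finset.card_le_card hk

namespace AlmostAdditive

variable {P : Finset (Fin d → ℤ) → ℝ}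

include hK0 hK in
-- The value `p` is the density of one fixed cube. It depends on `ε` but not on the sequence, which
-- forces all van Hove sequences to share their limit.
lemma eventually_near_cube (hP : AlmostAdditive K P) {ε : ℝ} (hε : 0 < ε) :
    ∃ p : ℝ, ∀ Λ : ℕ → Finset (Fin d → ℤ), IsVanHove Λ →
      ∀ᶠ k in atTop, |P (Λ k) / (Λ k).card - p| < ε := by
  have h1 := (tendsto_boundaryEnergy_cube hK0 hK).eventually (gt_mem_nhds (half_pos hε))
  obtain ⟨L, hL, hLpos⟩ := (h1.and (eventually_gt_atTop 0)).exists
  refine ⟨P (cube L 0) / (L : ℝ) ^ d, fun Λ hΛ => ?_⟩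
  have h2 := hΛ.boundary.const_mul (2 * (L : ℝ) ^ d * (|P {0}| + ∑' z, K z + ∑' z, K z))
  rw [mul_zero] at h2
  filter_upwards [h2.eventually (gt_mem_nhds (half_pos hε)), hΛ.eventually_nonempty] with k hk hne
  have := abs_sub_cube_le hK0 hK hP hLpos (Λ k) hne
  linarith

include hK0 hK in
/-- The thermodynamic limit of an almost additive function, with the same value along every
van Hove sequence. -/
theorem exists_limit (hP : AlmostAdditive K P) {Λ₀ : ℕ → Finset (Fin d → ℤ)}
    (hΛ₀ : IsVanHove Λ₀) :
    ∃ p : ℝ, ∀ Λ : ℕ → Finset (Fin d → ℤ), IsVanHove Λ →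
      Tendsto (fun k => P (Λ k) / (Λ k).card) atTop (𝓝 p) := by
  have hc : CauchySeq fun k => P (Λ₀ k) / (Λ₀ k).card := by
    rw [Metric.cauchySeq_iff]
    intro ε hε
    obtain ⟨p, hp⟩ := eventually_near_cube hK0 hK hP (half_pos hε)
    obtain ⟨N, hN⟩ := (hp Λ₀ hΛ₀).exists_forall_of_atTop
    refine ⟨N, fun m hm n hn => ?_⟩
    have h1 := abs_lt.mp (hN m hm)
    have h2 := abs_lt.mp (hN n hn)
    rw [Real.dist_eq, abs_lt]
    constructor <;> linarith [h1.1, h1.2, h2.1, h2.2]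
  obtain ⟨q, hq⟩ := cauchySeq_tendsto_of_complete hc
  refine ⟨q, fun Λ hΛ => ?_⟩
  rw [Metric.tendsto_nhds]
  intro ε hε
  obtain ⟨p, hp⟩ := eventually_near_cube hK0 hK hP (show 0 < ε / 4 by linarith)
  have h0 := hp Λ₀ hΛ₀
  have hqε := (Metric.tendsto_nhds.mp hq) (ε / 4) (by linarith)
  obtain ⟨k, hk1, hk2⟩ := (h0.and hqε).exists
  filter_upwards [hp Λ hΛ] with m hm
  rw [Real.dist_eq] at *
  rw [abs_lt] at *
  constructor <;> linarith [hk1.1, hk1.2, hk2.1, hk2.2, hm.1, hm.2]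

end AlmostAdditive

end AlmostAdditive

/-! ### Traces of matrix exponentials -/

section MatrixExp

open scoped Matrix Matrix.Norms.L2Operator

variable {m : Type*} [Fintype m] [DecidableEq m]

lemma norm_entry_le (X : Matrix m m ℂ) (i j : m) : ‖X i j‖ ≤ ‖X‖ := by
  have h := Matrix.l2_opNorm_mulVec X (EuclideanSpace.single j (1 : ℂ))
  rw [PiLp.norm_single, norm_one, mul_one] at h
  refine le_trans ?_ h
  have h2 := PiLp.norm_apply_le (WithLp.toLp 2 (X.mulVec (EuclideanSpace.single j (1 : ℂ)).ofLp)) i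
  refine le_trans (le_of_eq ?_) h2
  simp

lemma norm_star_mul_mul (U : Matrix.unitaryGroup m ℂ) (X : Matrix m m ℂ) :
    ‖star (U : Matrix m m ℂ) * X * U‖ = ‖X‖ := by
  rw [CStarRing.norm_mul_coe_unitary]
  exact CStarRing.norm_coe_unitary_mul (star U) X

variable {A B : Matrix m m ℂ}

lemma exp_smul_eq (hA : A.IsHermitian) (b : ℝ) :
    NormedSpace.exp ((b : ℂ) • A) = (hA.eigenvectorUnitary : Matrix m m ℂ) *
      Matrix.diagonal (fun i => (Real.exp (b * hA.eigenvalues i) : ℂ)) *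
      star (hA.eigenvectorUnitary : Matrix m m ℂ) := by
  set U := hA.eigenvectorUnitary
  have h1 : (b : ℂ) • A = (U : Matrix m m ℂ) *
      Matrix.diagonal (fun i => ((b * hA.eigenvalues i : ℝ) : ℂ)) * (U : Matrix m m ℂ)⁻¹ := by
    have h := hA.spectral_theorem
    rw [Unitary.conjStarAlgAut_apply] at h
    have hU : (U : Matrix m m ℂ)⁻¹ = star (U : Matrix m m ℂ) :=
      Matrix.inv_eq_left_inv (Unitary.coe_star_mul_self U)
    rw [hU]
    conv_lhs => rw [h]
    rw [← Matrix.smul_mul, ← Matrix.mul_smul, ← Matrix.diagonal_smul]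
    congr 3
    funext i
    simp
  have hUu : IsUnit (U : Matrix m m ℂ) := Unitary.isUnit_coe
  have hU : (U : Matrix m m ℂ)⁻¹ = star (U : Matrix m m ℂ) :=
    Matrix.inv_eq_left_inv (Unitary.coe_star_mul_self U)
  rw [h1, Matrix.exp_conj _ _ hUu, Matrix.exp_diagonal, hU]
  congr 3
  funext i
  rw [Pi.coe_exp, ← Complex.exp_eq_exp_ℂ, Complex.ofReal_exp]

lemma trace_mul_exp_smul (hA : A.IsHermitian) (X : Matrix m m ℂ) (b : ℝ) :
    (X * NormedSpace.exp ((b : ℂ) • A)).trace =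
      ∑ i, (star (hA.eigenvectorUnitary : Matrix m m ℂ) * X *
        (hA.eigenvectorUnitary : Matrix m m ℂ)) i i * (Real.exp (b * hA.eigenvalues i) : ℂ) := by
  rw [exp_smul_eq hA, ← mul_assoc, Matrix.trace_mul_comm, ← mul_assoc, ← mul_assoc]
  simp [Matrix.trace, Matrix.mul_diagonal]

lemma trace_exp_smul (hA : A.IsHermitian) (b : ℝ) :
    (NormedSpace.exp ((b : ℂ) • A)).trace = ((∑ i, Real.exp (b * hA.eigenvalues i) : ℝ) : ℂ) := by
  have h := trace_mul_exp_smul hA 1 b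
  rw [one_mul, mul_one, Unitary.coe_star_mul_self] at h
  rw [h]
  simp

lemma trace_exp (hA : A.IsHermitian) :
    (NormedSpace.exp A).trace = ((∑ i, Real.exp (hA.eigenvalues i) : ℝ) : ℂ) := by
  simpa using trace_exp_smul hA 1

lemma trace_exp_re_pos [Nonempty m] (hA : A.IsHermitian) : 0 < (NormedSpace.exp A).trace.re := by
  rw [trace_exp hA, Complex.ofReal_re]
  exact Finset.sum_pos (fun i _ => Real.exp_pos _) Finset.univ_nonempty

/-- For unitary `V` the numbers `‖V j i‖ ^ 2` are probabilities in `j`, so a diagonal entry is an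
average of eigenvalues and Jensen's inequality applies. -/
lemma conj_apply_self (V : Matrix m m ℂ) (v : m → ℝ) (i : m) :
    (star V * Matrix.diagonal (fun j => (v j : ℂ)) * V) i i =
      ((∑ j, ‖V j i‖ ^ 2 * v j : ℝ) : ℂ) := by
  rw [Matrix.mul_apply, Complex.ofReal_sum]
  refine Finset.sum_congr rfl fun j _ => ?_
  rw [Matrix.mul_diagonal, Matrix.star_apply, Complex.ofReal_mul, Complex.ofReal_pow]
  rw [← Complex.conj_mul', RCLike.star_def]
  ring

lemma unitary_col_norm (V : Matrix.unitaryGroup m ℂ) (i : m) :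
    ∑ j, ‖(V : Matrix m m ℂ) j i‖ ^ 2 = 1 := by
  have h := conj_apply_self (V : Matrix m m ℂ) (fun _ => 1) i
  simp only [Complex.ofReal_one, Matrix.diagonal_one, mul_one] at h
  rw [Unitary.coe_star_mul_self, Matrix.one_apply_eq] at h
  exact_mod_cast h.symm

lemma exp_apply_self_pos (hA : A.IsHermitian) (i : m) :
    0 < (NormedSpace.exp A i i).re ∧ (NormedSpace.exp A i i).im = 0 := by
  have h := exp_smul_eq hA 1
  rw [Complex.ofReal_one, one_smul] at h
  set V : Matrix.unitaryGroup m ℂ := star hA.eigenvectorUnitary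
  have h2 := conj_apply_self (V : Matrix m m ℂ) (fun j => Real.exp (1 * hA.eigenvalues j)) i
  have h3 : NormedSpace.exp A i i =
      ((∑ j, ‖(V : Matrix m m ℂ) j i‖ ^ 2 * Real.exp (1 * hA.eigenvalues j) : ℝ) : ℂ) := by
    rw [h, ← h2]
    simp [V]
  rw [h3]
  refine ⟨?_, Complex.ofReal_im _⟩
  rw [Complex.ofReal_re]
  have h1 := unitary_col_norm V i
  refine lt_of_le_of_ne (Finset.sum_nonneg fun j _ => by positivity) fun h0 => ?_
  have h4 := (Finset.sum_eq_zero_iff_of_nonneg (fun j _ => by positivity)).mp h0.symm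
  have h5 : ∑ j, ‖(V : Matrix m m ℂ) j i‖ ^ 2 = 0 := by
    refine Finset.sum_eq_zero fun j hj => ?_
    exact (mul_eq_zero.mp (h4 j hj)).resolve_right (Real.exp_pos _).ne'
  linarith

/-- Peierls' inequality. -/
lemma peierls (hB : B.IsHermitian) (U : Matrix.unitaryGroup m ℂ) :
    ∑ i, Real.exp ((star (U : Matrix m m ℂ) * B * U) i i).re ≤ (NormedSpace.exp B).trace.re := by
  set W : Matrix.unitaryGroup m ℂ := star hB.eigenvectorUnitary * U
  have hW : (W : Matrix m m ℂ) = star (hB.eigenvectorUnitary : Matrix m m ℂ) * U := by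
    simp [W]
  have e1 : star (U : Matrix m m ℂ) * B * U = star (W : Matrix m m ℂ) *
      Matrix.diagonal (fun j => (hB.eigenvalues j : ℂ)) * W := by
    have h := hB.spectral_theorem
    rw [Unitary.conjStarAlgAut_apply] at h
    conv_lhs => rw [h]
    rw [hW, star_mul, star_star]
    simp only [mul_assoc]
    rfl
  have hsum : ∀ j, ∑ i, ‖(W : Matrix m m ℂ) j i‖ ^ 2 = 1 := by
    intro j
    rw [← unitary_col_norm (star W) j]
    refine Finset.sum_congr rfl fun i _ => ?_
    simp [Matrix.star_apply]
  calc ∑ i, Real.exp ((star (U : Matrix m m ℂ) * B * U) i i).re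
      ≤ ∑ i, ∑ j, ‖(W : Matrix m m ℂ) j i‖ ^ 2 * Real.exp (hB.eigenvalues j) := by
        refine Finset.sum_le_sum fun i _ => ?_
        rw [e1, conj_apply_self, Complex.ofReal_re]
        have := convexOn_exp.map_sum_le (t := Finset.univ)
          (w := fun j => ‖(W : Matrix m m ℂ) j i‖ ^ 2) (p := hB.eigenvalues)
          (fun j _ => by positivity) (unitary_col_norm W i) (fun _ _ => Set.mem_univ _)
        simpa using this
    _ = ∑ j, Real.exp (hB.eigenvalues j) := by
        rw [Finset.sum_comm]
        refine Finset.sum_congr rfl fun j _ => ?_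
        rw [← Finset.sum_mul, hsum, one_mul]
    _ = _ := by rw [trace_exp hB, Complex.ofReal_re]

/-- In the eigenbasis of `A`, the diagonal entries of `B` differ from the eigenvalues of `A` by at
most `‖A - B‖`; Peierls' inequality for `B` in this basis concludes. -/
lemma trace_exp_le (hA : A.IsHermitian) (hB : B.IsHermitian) :
    (NormedSpace.exp A).trace.re ≤ Real.exp ‖A - B‖ * (NormedSpace.exp B).trace.re := by
  set U := hA.eigenvectorUnitary
  have hdiag : star (U : Matrix m m ℂ) * A * U =
      Matrix.diagonal (fun j => (hA.eigenvalues j : ℂ)) := by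
    have h := hA.conjStarAlgAut_star_eigenvectorUnitary
    rw [Unitary.conjStarAlgAut_apply] at h
    simp only [star_star, Unitary.coe_star] at h
    exact h
  rw [trace_exp hA, Complex.ofReal_re]
  refine le_trans ?_ (mul_le_mul_of_nonneg_left (peierls (B := B) hB U) (Real.exp_pos _).le)
  rw [Finset.mul_sum]
  refine Finset.sum_le_sum fun i _ => ?_
  rw [← Real.exp_add, Real.exp_le_exp]
  have h1 : (hA.eigenvalues i : ℂ) - (star (U : Matrix m m ℂ) * B * U) i i =
      (star (U : Matrix m m ℂ) * (A - B) * U) i i := by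
    rw [mul_sub, sub_mul, hdiag, Matrix.sub_apply, Matrix.diagonal_apply_eq]
  have h2 := (norm_entry_le (star (U : Matrix m m ℂ) * (A - B) * (U : Matrix m m ℂ)) i i).trans
    (norm_star_mul_mul U (A - B)).le
  rw [← h1] at h2
  have h3 := (Complex.re_le_norm _).trans h2
  rw [Complex.sub_re, Complex.ofReal_re] at h3
  linarith

lemma abs_log_trace_exp_sub_le [Nonempty m] (hA : A.IsHermitian) (hB : B.IsHermitian) :
    |Real.log (NormedSpace.exp A).trace.re - Real.log (NormedSpace.exp B).trace.re| ≤ ‖A - B‖ := by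
  have key : ∀ {A B : Matrix m m ℂ}, A.IsHermitian → B.IsHermitian →
      Real.log (NormedSpace.exp A).trace.re ≤
        ‖A - B‖ + Real.log (NormedSpace.exp B).trace.re := by
    intro A B hA hB
    have h := Real.log_le_log (trace_exp_re_pos hA) (trace_exp_le hA hB)
    rwa [Real.log_mul (Real.exp_pos _).ne' (trace_exp_re_pos hB).ne', Real.log_exp] at h
  have h1 := key hA hB
  have h2 := key hB hA
  rw [norm_sub_rev] at h2
  rw [abs_le]
  constructor <;> linarith

lemma exp_mul_tendsto_ite {a c : ℝ} (h : a ≤ c) :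
    Tendsto (fun b : ℝ => Real.exp (b * (a - c))) atTop (𝓝 (if a = c then 1 else 0)) := by
  split_ifs with hac
  · simp [hac]
  · refine Real.tendsto_exp_atBot.comp ?_
    exact tendsto_id.atTop_mul_const_of_neg (sub_neg.mpr (lt_of_le_of_ne h hac))

/-- After division by `exp (b c)`, with `c` the largest eigenvalue, only the top eigenspace
survives. The denominator tends to the multiplicity of `c`, which is nonzero. -/
lemma exists_tendsto_trace_div [Nonempty m] (hA : A.IsHermitian) (X : Matrix m m ℂ) :
    ∃ L : ℂ, Tendsto (fun b : ℝ => (X * NormedSpace.exp ((b : ℂ) • A)).trace /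
      ((NormedSpace.exp ((b : ℂ) • A)).trace.re : ℂ)) atTop (𝓝 L) := by
  obtain ⟨i₀, hi₀⟩ := Finite.exists_max hA.eigenvalues
  set c := hA.eigenvalues i₀
  set Y := star (hA.eigenvectorUnitary : Matrix m m ℂ) * X *
        (hA.eigenvectorUnitary : Matrix m m ℂ)
  have hnum : Tendsto (fun b : ℝ => ∑ i, Y i i * (Real.exp (b * (hA.eigenvalues i - c)) : ℂ)) atTop
      (𝓝 (∑ i, Y i i * ((if hA.eigenvalues i = c then 1 else 0 : ℝ) : ℂ))) := by
    refine tendsto_finsetSum _ fun i _ => Tendsto.const_mul _ ?_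
    exact (Complex.continuous_ofReal.tendsto _).comp (exp_mul_tendsto_ite (hi₀ i))
  have hden : Tendsto (fun b : ℝ => ((∑ i, Real.exp (b * (hA.eigenvalues i - c)) : ℝ) : ℂ)) atTop
      (𝓝 ((∑ i, (if hA.eigenvalues i = c then 1 else 0 : ℝ) : ℝ) : ℂ)) := by
    refine (Complex.continuous_ofReal.tendsto _).comp ?_
    exact tendsto_finsetSum _ fun i _ => exp_mul_tendsto_ite (hi₀ i)
  have hne : ((∑ i, (if hA.eigenvalues i = c then 1 else 0 : ℝ) : ℝ) : ℂ) ≠ 0 := by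
    rw [Complex.ofReal_ne_zero]
    refine (Finset.sum_pos' (fun i _ => by split_ifs <;> norm_num)
      ⟨i₀, Finset.mem_univ _, by simp [c]⟩).ne'
  refine ⟨_, (hnum.div hden hne).congr fun b => ?_⟩
  rw [trace_mul_exp_smul hA, trace_exp_smul hA, Complex.ofReal_re]
  have e : ∀ i, Real.exp (b * (hA.eigenvalues i - c)) =
      Real.exp (b * hA.eigenvalues i) * Real.exp (-(b * c)) := fun i => by
    rw [← Real.exp_add]; ring_nf
  simp only [Pi.div_apply, e, Complex.ofReal_mul, ← mul_assoc, ← Finset.sum_mul]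
  rw [mul_div_mul_right]
  exact Complex.ofReal_ne_zero.mpr (Real.exp_pos _).ne'

lemma exists_tendsto_log_trace [Nonempty m] (hA : A.IsHermitian) :
    ∃ L : ℝ, Tendsto (fun b : ℝ => 1 / b * Real.log (NormedSpace.exp ((b : ℂ) • A)).trace.re)
      atTop (𝓝 L) := by
  obtain ⟨i₀, hi₀⟩ := Finite.exists_max hA.eigenvalues
  set c := hA.eigenvalues i₀
  have hden : Tendsto (fun b : ℝ => ∑ i, Real.exp (b * (hA.eigenvalues i - c))) atTop
      (𝓝 (∑ i, (if hA.eigenvalues i = c then 1 else 0 : ℝ))) :=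
    tendsto_finsetSum _ fun i _ => exp_mul_tendsto_ite (hi₀ i)
  have hpos : (∑ i, (if hA.eigenvalues i = c then 1 else 0 : ℝ)) ≠ 0 :=
    (Finset.sum_pos' (fun i _ => by split_ifs <;> norm_num)
      ⟨i₀, Finset.mem_univ _, by simp [c]⟩).ne'
  have hlog := tendsto_inv_atTop_zero.mul (hden.log hpos)
  have h2 := hlog.const_add c
  rw [zero_mul] at h2
  refine ⟨_, h2.congr' ?_⟩
  filter_upwards [eventually_gt_atTop 0] with b hb
  rw [trace_exp_smul hA, Complex.ofReal_re]
  have e : ∀ i, Real.exp (b * hA.eigenvalues i) =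
      Real.exp (b * (hA.eigenvalues i - c)) * Real.exp (b * c) := fun i => by
    rw [← Real.exp_add]; ring_nf
  have hp : 0 < ∑ i, Real.exp (b * (hA.eigenvalues i - c)) :=
    Finset.sum_pos (fun i _ => Real.exp_pos _) Finset.univ_nonempty
  simp only [e, ← Finset.sum_mul]
  rw [Real.log_mul hp.ne' (Real.exp_pos _).ne', Real.log_exp]
  field_simp
  ring

variable {l : Type*} [Fintype l] [DecidableEq l]

lemma map_matrix_exp {F : Type*} [FunLike F (Matrix m m ℂ) (Matrix l l ℂ)]
    [RingHomClass F (Matrix m m ℂ) (Matrix l l ℂ)] (f : F) (hf : Continuous f)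
    (X : Matrix m m ℂ) : f (NormedSpace.exp X) = NormedSpace.exp (f X) :=
  NormedSpace.map_exp_of_mem_ball (𝕂 := ℂ) f hf X <|
    (NormedSpace.expSeries_radius_eq_top ℂ (Matrix m m ℂ)).symm ▸ edist_lt_top _ _

lemma exp_reindex (e : m ≃ l) (X : Matrix m m ℂ) :
    NormedSpace.exp (Matrix.reindex e e X) = Matrix.reindex e e (NormedSpace.exp X) := by
  have hc : Continuous (Matrix.reindexAlgEquiv ℚ ℂ e) := by
    refine continuous_matrix fun i j => ?_
    exact continuous_id.matrix_elem _ _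
  exact (map_matrix_exp (Matrix.reindexAlgEquiv ℚ ℂ e) hc X).symm

omit [DecidableEq m] [DecidableEq l] in
lemma trace_reindex (e : m ≃ l) (X : Matrix m m ℂ) : (Matrix.reindex e e X).trace = X.trace := by
  simp only [Matrix.trace, Matrix.diag_apply, Matrix.reindex_apply, Matrix.submatrix_apply]
  exact e.symm.sum_comp fun i => X i i

open scoped Kronecker

lemma exp_kronecker_one (X : Matrix m m ℂ) :
    NormedSpace.exp (X ⊗ₖ (1 : Matrix l l ℂ)) = NormedSpace.exp X ⊗ₖ (1 : Matrix l l ℂ) := by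
  let f : Matrix m m ℂ →+* Matrix (m × l) (m × l) ℂ :=
    { toFun := fun X => X ⊗ₖ 1
      map_one' := Matrix.one_kronecker_one
      map_mul' := fun X Y => by rw [← Matrix.mul_kronecker_mul, one_mul]
      map_zero' := Matrix.zero_kronecker _
      map_add' := fun X Y => Matrix.add_kronecker _ _ _ }
  have hc : Continuous f := by
    refine continuous_matrix fun i j => ?_
    exact (continuous_id.matrix_elem _ _).mul continuous_const
  exact (map_matrix_exp f hc X).symm

lemma exp_one_kronecker (X : Matrix l l ℂ) :
    NormedSpace.exp ((1 : Matrix m m ℂ) ⊗ₖ X) = (1 : Matrix m m ℂ) ⊗ₖ NormedSpace.exp X := by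
  let f : Matrix l l ℂ →+* Matrix (m × l) (m × l) ℂ :=
    { toFun := fun X => 1 ⊗ₖ X
      map_one' := Matrix.one_kronecker_one
      map_mul' := fun X Y => by rw [← Matrix.mul_kronecker_mul, one_mul]
      map_zero' := Matrix.kronecker_zero _
      map_add' := fun X Y => Matrix.kronecker_add _ _ _ }
  have hc : Continuous f := by
    refine continuous_matrix fun i j => ?_
    exact continuous_const.mul (continuous_id.matrix_elem _ _)
  exact (map_matrix_exp f hc X).symm

/-- The two summands act on different factors and commute: partition functions of decoupled regions
multiply. -/
lemma trace_exp_kronecker_sum (X : Matrix m m ℂ) (Y : Matrix l l ℂ) :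
    (NormedSpace.exp (X ⊗ₖ (1 : Matrix l l ℂ) + (1 : Matrix m m ℂ) ⊗ₖ Y)).trace =
      (NormedSpace.exp X).trace * (NormedSpace.exp Y).trace := by
  rw [Matrix.exp_add_of_commute, exp_kronecker_one, exp_one_kronecker, ← Matrix.mul_kronecker_mul,
    mul_one, one_mul, Matrix.trace_kronecker]
  rw [Commute, SemiconjBy, ← Matrix.mul_kronecker_mul, ← Matrix.mul_kronecker_mul]
  simp

end MatrixExp

/-! ### Spin operators and the dependence of `log Z` on the couplings -/

section SiteOperators

open scoped Matrix Matrix.Norms.L2Operator Kronecker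

variable {ι : Type*} [Fintype ι] [DecidableEq ι] {n : ℕ}

lemma siteOp_eq_submatrix (x : ι) (A : Matrix (Fin n) (Fin n) ℂ) :
    siteOp x A = (A ⊗ₖ (1 : Matrix ({y // y ≠ x} → Fin n) ({y // y ≠ x} → Fin n) ℂ)).submatrix
      (Equiv.funSplitAt x (Fin n)) (Equiv.funSplitAt x (Fin n)) := by
  ext σ τ
  simp only [siteOp, Matrix.of_apply, Matrix.submatrix_apply, Matrix.kronecker_apply,
    Matrix.one_apply, Equiv.funSplitAt_apply, funext_iff, Subtype.forall, mul_ite, mul_one,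
    mul_zero]

/-- Operators of one site as a star homomorphism. -/
noncomputable def siteHom (x : ι) :
    Matrix (Fin n) (Fin n) ℂ →⋆ₙₐ[ℂ] Matrix (ι → Fin n) (ι → Fin n) ℂ where
  toFun := siteOp x
  map_smul' c A := by
    simp only [siteOp_eq_submatrix, Matrix.smul_kronecker, Matrix.submatrix_smul]
    rfl
  map_zero' := by simp [siteOp_eq_submatrix]
  map_add' A B := by
    simp only [siteOp_eq_submatrix, Matrix.add_kronecker, Matrix.submatrix_add]
    rfl
  map_mul' A B := by
    simp only [siteOp_eq_submatrix]
    rw [Matrix.submatrix_mul_equiv, ← Matrix.mul_kronecker_mul, one_mul]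
  map_star' A := by
    simp only [siteOp_eq_submatrix, Matrix.star_eq_conjTranspose, Matrix.conjTranspose_submatrix,
      Matrix.conjTranspose_kronecker, Matrix.conjTranspose_one]

lemma siteHom_apply (x : ι) (A : Matrix (Fin n) (Fin n) ℂ) : siteHom x A = siteOp x A := rfl

/-- Star homomorphisms of C⋆-algebras are contractive; the bound does not see the volume. -/
lemma norm_siteOp_le (x : ι) (A : Matrix (Fin n) (Fin n) ℂ) : ‖siteOp x A‖ ≤ ‖A‖ :=
  NonUnitalStarAlgHom.norm_apply_le (siteHom x) A

lemma siteOp_isHermitian (x : ι) {A : Matrix (Fin n) (Fin n) ℂ} (hA : A.IsHermitian) :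
    (siteOp x A).IsHermitian := by
  have h := map_star (siteHom x) A
  rw [Matrix.star_eq_conjTranspose, hA.eq] at h
  exact h.symm

lemma spin_isHermitian (n : ℕ) (i : Fin 3) : (spin n i).IsHermitian := by
  unfold Matrix.IsHermitian
  fin_cases i
  · simp [spin, Matrix.conjTranspose_smul, Matrix.conjTranspose_add, add_comm]
  · simp only [spin, Fin.mk_one, Matrix.cons_val_one, Matrix.cons_val_zero,
      Matrix.conjTranspose_smul, Matrix.conjTranspose_sub, Matrix.conjTranspose_conjTranspose]
    rw [← neg_sub (raising n), smul_neg, ← neg_smul]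
    congr 1
    simp [neg_div]
  · simp only [spin, Fin.reduceFinMk, Matrix.cons_val, Matrix.diagonal_conjTranspose]
    congr 1
    funext k
    simp

/-- The Hamiltonian with pair couplings `c` between the sites of `ι`. -/
noncomputable def pairHamiltonian (n : ℕ) (c : Fin 3 → ι → ι → ℝ) (h : ℝ) :
    Matrix (ι → Fin n) (ι → Fin n) ℂ :=
  -(∑ i : Fin 3, ∑ x : ι, ∑ y : ι, (c i x y : ℂ) • (siteOp x (spin n i) * siteOp y (spin n i)))
    - (h : ℂ) • ∑ x : ι, siteOp x (spin n 2)

lemma pairHamiltonian_isHermitian {c : Fin 3 → ι → ι → ℝ} (hc : ∀ i x y, c i x y = c i y x)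
    (h : ℝ) : (pairHamiltonian n c h).IsHermitian := by
  refine Matrix.IsHermitian.sub (Matrix.IsHermitian.neg ?_) ?_
  · unfold Matrix.IsHermitian
    rw [Matrix.conjTranspose_sum]
    refine Finset.sum_congr rfl fun i _ => ?_
    rw [Matrix.conjTranspose_sum, Finset.sum_comm]
    refine Finset.sum_congr rfl fun x _ => ?_
    rw [Matrix.conjTranspose_sum]
    refine Finset.sum_congr rfl fun y _ => ?_
    rw [Matrix.conjTranspose_smul, Matrix.conjTranspose_mul,
      (siteOp_isHermitian x (spin_isHermitian n i)).eq,
      (siteOp_isHermitian y (spin_isHermitian n i)).eq, hc i x y]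
    simp
  · unfold Matrix.IsHermitian
    rw [Matrix.conjTranspose_smul, Matrix.conjTranspose_sum]
    simp [fun x : ι => (siteOp_isHermitian x (spin_isHermitian n 2)).eq]

/-- The logarithm of the partition function with pair couplings `c`. -/
noncomputable def logPartition (n : ℕ) (c : Fin 3 → ι → ι → ℝ) (b h : ℝ) : ℝ :=
  Real.log (NormedSpace.exp (-((b : ℂ) • pairHamiltonian n c h))).trace.re

lemma neg_smul_isHermitian {m : Type*} {A : Matrix m m ℂ} (hA : A.IsHermitian) (b : ℝ) :
    (-((b : ℂ) • A)).IsHermitian := by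
  refine Matrix.IsHermitian.neg ?_
  unfold Matrix.IsHermitian
  rw [Matrix.conjTranspose_smul, hA.eq]
  simp

/-- A bound for the norm of the product of two spin operators. -/
noncomputable def spinBound (n : ℕ) : ℝ := ∑ i, ‖spin n i‖ ^ 2

lemma spinBound_nonneg (n : ℕ) : 0 ≤ spinBound n := Finset.sum_nonneg fun _ _ => by positivity

lemma norm_siteOp_mul_le (i : Fin 3) (x y : ι) :
    ‖siteOp x (spin n i) * siteOp y (spin n i)‖ ≤ spinBound n := by
  refine (norm_mul_le _ _).trans ?_
  refine le_trans ?_ (Finset.single_le_sum (f := fun i => ‖spin n i‖ ^ 2)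
    (fun _ _ => by positivity) (Finset.mem_univ i))
  rw [pow_two]
  exact mul_le_mul (norm_siteOp_le _ _) (norm_siteOp_le _ _) (norm_nonneg _) (norm_nonneg _)

/-- The field terms cancel in the difference of the Hamiltonians, so the bound is free of `h`. -/
lemma abs_logPartition_sub_le [NeZero n] {c c' : Fin 3 → ι → ι → ℝ}
    (hc : ∀ i x y, c i x y = c i y x) (hc' : ∀ i x y, c' i x y = c' i y x) {b : ℝ} (hb : 0 ≤ b)
    (h : ℝ) :
    |logPartition n c b h - logPartition n c' b h| ≤
      b * ∑ i, ∑ x, ∑ y, |c i x y - c' i x y| * spinBound n := by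
  refine (abs_log_trace_exp_sub_le (neg_smul_isHermitian (pairHamiltonian_isHermitian hc h) b)
    (neg_smul_isHermitian (pairHamiltonian_isHermitian hc' h) b)).trans ?_
  have e : -((b : ℂ) • pairHamiltonian n c h) - -((b : ℂ) • pairHamiltonian n c' h) =
      (b : ℂ) • ∑ i, ∑ x, ∑ y, ((c i x y - c' i x y : ℝ) : ℂ) •
        (siteOp x (spin n i) * siteOp y (spin n i)) := by
    simp only [pairHamiltonian, Complex.ofReal_sub, sub_smul, Finset.sum_sub_distrib]
    rw [neg_sub_neg, ← smul_sub]
    congr 1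
    abel
  rw [e, norm_smul, Complex.norm_real, Real.norm_of_nonneg hb]
  refine mul_le_mul_of_nonneg_left ?_ hb
  refine (norm_sum_le _ _).trans (Finset.sum_le_sum fun i _ => ?_)
  refine (norm_sum_le _ _).trans (Finset.sum_le_sum fun x _ => ?_)
  refine (norm_sum_le _ _).trans (Finset.sum_le_sum fun y _ => ?_)
  rw [norm_smul, Complex.norm_real, Real.norm_eq_abs]
  exact mul_le_mul_of_nonneg_left (norm_siteOp_mul_le i x y) (abs_nonneg _)

section Reindex

variable {κ : Type*} [Fintype κ] [DecidableEq κ]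

lemma reindex_siteOp (e : ι ≃ κ) (x : ι) (A : Matrix (Fin n) (Fin n) ℂ) :
    Matrix.reindexAlgEquiv ℂ ℂ (e.arrowCongr (Equiv.refl (Fin n))) (siteOp x A) =
      siteOp (e x) A := by
  ext σ τ
  simp only [Matrix.coe_reindexAlgEquiv, Matrix.reindex_apply, Matrix.submatrix_apply, siteOp,
    Matrix.of_apply, Equiv.arrowCongr_symm, Equiv.arrowCongr_apply, Equiv.refl_symm,
    Equiv.coe_refl, Function.comp_apply, Equiv.symm_symm, id_eq]
  have : (∀ y, y ≠ x → σ (e y) = τ (e y)) ↔ ∀ y, y ≠ e x → σ y = τ y := by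
    constructor
    · intro h y hy
      simpa using h (e.symm y) fun h' => hy (by simp [← h'])
    · intro h y hy
      exact h _ fun h' => hy (e.injective h')
  simp only [this]

lemma reindex_pairHamiltonian (e : ι ≃ κ) (c : Fin 3 → κ → κ → ℝ) (h : ℝ) :
    Matrix.reindexAlgEquiv ℂ ℂ (e.arrowCongr (Equiv.refl (Fin n)))
      (pairHamiltonian n (fun i x y => c i (e x) (e y)) h) = pairHamiltonian n c h := by
  simp only [pairHamiltonian, map_sub, map_neg, map_sum, map_smul, map_mul, reindex_siteOp]
  congr 2
  · refine Finset.sum_congr rfl fun i _ => ?_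
    rw [← e.sum_comp]
    refine Finset.sum_congr rfl fun x _ => ?_
    exact e.sum_comp fun y => (c i (e x) y : ℂ) • (siteOp (e x) (spin n i) * siteOp y (spin n i))
  · rw [e.sum_comp fun x => siteOp x (spin n 2)]

lemma logPartition_equiv (e : ι ≃ κ) (c : Fin 3 → κ → κ → ℝ) (b h : ℝ) :
    logPartition n (fun i x y => c i (e x) (e y)) b h = logPartition n c b h := by
  unfold logPartition
  rw [← reindex_pairHamiltonian e c h, ← map_smul, ← map_neg, Matrix.coe_reindexAlgEquiv,
    exp_reindex, trace_reindex]

lemma reindex_siteOp_inl (x : ι) (A : Matrix (Fin n) (Fin n) ℂ) :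
    Matrix.reindexAlgEquiv ℂ ℂ (Equiv.sumArrowEquivProdArrow ι κ (Fin n)) (siteOp (Sum.inl x) A) =
      siteOp x A ⊗ₖ (1 : Matrix (κ → Fin n) (κ → Fin n) ℂ) := by
  ext ⟨σ, σ'⟩ ⟨τ, τ'⟩
  simp only [Matrix.coe_reindexAlgEquiv, Matrix.reindex_apply, Matrix.submatrix_apply, siteOp,
    Matrix.of_apply, Matrix.kronecker_apply, Matrix.one_apply, Sum.forall, funext_iff,
    Equiv.sumArrowEquivProdArrow_symm_apply_inl, Equiv.sumArrowEquivProdArrow_symm_apply_inr,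
    ne_eq, Sum.inl.injEq, reduceCtorEq, not_false_eq_true, forall_const, mul_ite, mul_one,
    mul_zero, ite_and]
  grind

lemma reindex_siteOp_inr (y : κ) (A : Matrix (Fin n) (Fin n) ℂ) :
    Matrix.reindexAlgEquiv ℂ ℂ (Equiv.sumArrowEquivProdArrow ι κ (Fin n)) (siteOp (Sum.inr y) A) =
      (1 : Matrix (ι → Fin n) (ι → Fin n) ℂ) ⊗ₖ siteOp y A := by
  ext ⟨σ, σ'⟩ ⟨τ, τ'⟩
  simp only [Matrix.coe_reindexAlgEquiv, Matrix.reindex_apply, Matrix.submatrix_apply, siteOp,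
    Matrix.of_apply, Matrix.kronecker_apply, Matrix.one_apply, Sum.forall, funext_iff,
    Equiv.sumArrowEquivProdArrow_symm_apply_inl, Equiv.sumArrowEquivProdArrow_symm_apply_inr,
    ne_eq, Sum.inr.injEq, reduceCtorEq, not_false_eq_true, forall_const, ite_mul, one_mul,
    zero_mul, ite_and]
  grind

/-- The couplings `c` on a disjoint union, without those between the two parts. -/
def blockCoupling (c : Fin 3 → ι ⊕ κ → ι ⊕ κ → ℝ) : Fin 3 → ι ⊕ κ → ι ⊕ κ → ℝ
  | i, Sum.inl x, Sum.inl y => c i (Sum.inl x) (Sum.inl y)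
  | i, Sum.inr x, Sum.inr y => c i (Sum.inr x) (Sum.inr y)
  | _, _, _ => 0

lemma sum_kronecker {α l m : Type*} (s : Finset α) (f : α → Matrix l l ℂ) (B : Matrix m m ℂ) :
    (∑ a ∈ s, f a) ⊗ₖ B = ∑ a ∈ s, f a ⊗ₖ B := by
  ext i j
  simp [Matrix.sum_apply, Finset.sum_mul]

lemma kronecker_sum {α l m : Type*} (s : Finset α) (B : Matrix l l ℂ) (f : α → Matrix m m ℂ) :
    B ⊗ₖ (∑ a ∈ s, f a) = ∑ a ∈ s, B ⊗ₖ f a := by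
  ext i j
  simp [Matrix.sum_apply, Finset.mul_sum]

lemma neg_kronecker' {l m : Type*} (A : Matrix l l ℂ) (B : Matrix m m ℂ) :
    (-A) ⊗ₖ B = -(A ⊗ₖ B) := by
  ext i j
  simp

lemma kronecker_neg' {l m : Type*} (A : Matrix l l ℂ) (B : Matrix m m ℂ) :
    A ⊗ₖ (-B) = -(A ⊗ₖ B) := by
  ext i j
  simp

lemma reindex_pairHamiltonian_blockCoupling (c : Fin 3 → ι ⊕ κ → ι ⊕ κ → ℝ) (h : ℝ) :
    Matrix.reindexAlgEquiv ℂ ℂ (Equiv.sumArrowEquivProdArrow ι κ (Fin n))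
      (pairHamiltonian n (blockCoupling c) h) =
    pairHamiltonian n (fun i x y => c i (Sum.inl x) (Sum.inl y)) h ⊗ₖ
        (1 : Matrix (κ → Fin n) (κ → Fin n) ℂ) +
      (1 : Matrix (ι → Fin n) (ι → Fin n) ℂ) ⊗ₖ
        pairHamiltonian n (fun i x y => c i (Sum.inr x) (Sum.inr y)) h := by
  simp only [pairHamiltonian, map_add, map_neg, map_sum, map_smul, map_mul, Fintype.sum_sum_type,
    reindex_siteOp_inl, reindex_siteOp_inr, blockCoupling, Complex.ofReal_zero, zero_smul,
    Finset.sum_const_zero, add_zero, zero_add, ← Matrix.mul_kronecker_mul, mul_one,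
    sub_eq_add_neg, Matrix.add_kronecker, Matrix.kronecker_add, neg_kronecker', kronecker_neg',
    sum_kronecker, kronecker_sum, Matrix.smul_kronecker, Matrix.kronecker_smul,
    Finset.sum_add_distrib, smul_add]
  abel

lemma logPartition_blockCoupling [NeZero n] {c : Fin 3 → ι ⊕ κ → ι ⊕ κ → ℝ}
    (hc : ∀ i x y, c i x y = c i y x) (b h : ℝ) :
    logPartition n (blockCoupling c) b h =
      logPartition n (fun i x y => c i (Sum.inl x) (Sum.inl y)) b h +
      logPartition n (fun i x y => c i (Sum.inr x) (Sum.inr y)) b h := by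
  unfold logPartition
  have h1 := neg_smul_isHermitian (pairHamiltonian_isHermitian (n := n)
    (c := fun i x y => c i (Sum.inl x) (Sum.inl y)) (fun i x y => hc _ _ _) h) b
  have h2 := neg_smul_isHermitian (pairHamiltonian_isHermitian (n := n)
    (c := fun i x y => c i (Sum.inr x) (Sum.inr y)) (fun i x y => hc _ _ _) h) b
  rw [← Real.log_mul (trace_exp_re_pos h1).ne' (trace_exp_re_pos h2).ne']
  congr 1
  rw [← trace_reindex (Equiv.sumArrowEquivProdArrow ι κ (Fin n)), ← exp_reindex,
    ← Matrix.coe_reindexAlgEquiv ℂ ℂ, map_neg, map_smul, reindex_pairHamiltonian_blockCoupling,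
    smul_add, neg_add, ← Matrix.smul_kronecker, ← Matrix.kronecker_smul, ← neg_kronecker',
    ← kronecker_neg', trace_exp_kronecker_sum, trace_exp h1, trace_exp h2]
  simp

end Reindex

end SiteOperators

/-! ### Almost additivity of the pressure -/

section AlmostAdditivity

variable {d : ℕ} {J : Fin 3 → (Fin d → ℤ) → ℝ}

/-- The strength of the interaction of two sites. -/
noncomputable def pairBound (n : ℕ) (J : Fin 3 → (Fin d → ℤ) → ℝ) (z : Fin d → ℤ) : ℝ :=
  2 * spinBound n * ∑ i, |J i z|

lemma pairBound_nonneg (n : ℕ) (z : Fin d → ℤ) : 0 ≤ pairBound n J z := by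
  have := spinBound_nonneg n
  unfold pairBound
  positivity

lemma pairBound_summable (n : ℕ) (hsum : ∀ i, Summable fun x => |J i x|) :
    Summable (pairBound n J) :=
  (summable_sum fun i _ => hsum i).mul_left _

/-- The finite-volume pressure `β⁻¹ log Z`, not divided by the volume. -/
noncomputable def pressure (n : ℕ) (J : Fin 3 → (Fin d → ℤ) → ℝ) (b h : ℝ)
    (Λ : Finset (Fin d → ℤ)) : ℝ :=
  1 / b * Real.log (partitionFunction n J Λ b h)

lemma log_partitionFunction (n : ℕ) (Λ : Finset (Fin d → ℤ)) (b h : ℝ) :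
    Real.log (partitionFunction n J Λ b h) =
      logPartition n (fun i (x y : Λ) => J i (x.val - y.val)) b h := rfl

lemma coupling_symm (hsymm : ∀ i x, J i (-x) = J i x) (i : Fin 3) (x y : Fin d → ℤ) :
    J i (x - y) = J i (y - x) := by
  rw [← hsymm, neg_sub]

/-- Without the couplings between `A` and `B`, `log Z` is additive. Restoring them costs a multiple
of `b`, which the prefactor `1 / b` cancels; hence the uniformity needed for zero temperature. -/
lemma pressure_almostAdditive {n : ℕ} [NeZero n] (hsymm : ∀ i x, J i (-x) = J i x) {b : ℝ}
    (hb : 0 < b) (h : ℝ) : AlmostAdditive (pairBound n J) (pressure n J b h) where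
  union A B hAB := by
    set e := Equiv.Finset.union A B hAB
    set c : Fin 3 → A ⊕ B → A ⊕ B → ℝ := fun i x y => J i ((e x).val - (e y).val)
    have hc : ∀ i x y, c i x y = c i y x := fun i x y => coupling_symm hsymm i _ _
    have hc' : ∀ i x y, blockCoupling c i x y = blockCoupling c i y x := by
      rintro i (x | x) (y | y)
      exacts [hc _ _ _, rfl, rfl, hc _ _ _]
    have h1 := abs_logPartition_sub_le (n := n) hc hc' hb.le h
    rw [logPartition_blockCoupling hc] at h1
    have e1 : logPartition n c b h = Real.log (partitionFunction n J (A ∪ B) b h) :=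
      logPartition_equiv e (fun i (x y : ↥(A ∪ B)) => J i (x.val - y.val)) b h
    have e2 : logPartition n (fun i x y => c i (Sum.inl x) (Sum.inl y)) b h =
      Real.log (partitionFunction n J A b h) := rfl
    have e3 : logPartition n (fun i x y => c i (Sum.inr x) (Sum.inr y)) b h =
      Real.log (partitionFunction n J B b h) := rfl
    rw [e1, e2, e3] at h1
    have e4 : ∑ i, ∑ x, ∑ y, |c i x y - blockCoupling c i x y| * spinBound n =
        ∑ x ∈ A, ∑ y ∈ B, pairBound n J (x - y) := by
      have e5 : ∀ i : Fin 3, ∑ x, ∑ y, |c i x y - blockCoupling c i x y| * spinBound n =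
          ∑ x : A, ∑ y : B, 2 * spinBound n * |J i (x.val - y.val)| := by
        intro i
        simp only [Fintype.sum_sum_type, blockCoupling, sub_self, abs_zero, zero_mul,
          Finset.sum_const_zero, add_zero, zero_add, sub_zero]
        -- The Hamiltonian sums over ordered pairs; folding `B × A` onto `A × B` produces the factor
        -- 2 of `pairBound`.
        rw [Finset.sum_comm (s := (Finset.univ : Finset B)), ← Finset.sum_add_distrib]
        refine Finset.sum_congr rfl fun x _ => ?_
        rw [← Finset.sum_add_distrib]
        refine Finset.sum_congr rfl fun y _ => ?_
        rw [hc i (Sum.inr y) (Sum.inl x)]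
        have : c i (Sum.inl x) (Sum.inr y) = J i (x.val - y.val) := rfl
        rw [this]
        ring
      simp only [e5]
      rw [Finset.sum_comm, ← Finset.sum_coe_sort A]
      refine Finset.sum_congr rfl fun x _ => ?_
      rw [Finset.sum_comm, ← Finset.sum_coe_sort B]
      refine Finset.sum_congr rfl fun y _ => ?_
      rw [← Finset.mul_sum]
      rfl
    rw [e4] at h1
    unfold pressure
    rw [← mul_sub, ← mul_sub, abs_mul, abs_of_pos (one_div_pos.mpr hb), one_div,
      inv_mul_le_iff₀ hb, sub_sub]
    exact h1
  translate A v := by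
    unfold pressure
    congr 1
    rw [log_partitionFunction, log_partitionFunction,
      ← logPartition_equiv ((Equiv.addRight v).subtypeEquiv (p := (· ∈ A))
        (q := (· ∈ A.map (addRightEmbedding v))) (by simp))]
    simp

end AlmostAdditivity

/-! ### Inequalities for exponential sums with positive weights -/

section Weights

variable {Ω : Type*} [Fintype Ω]

lemma log_sum_exp_convexOn [Nonempty Ω] (w m : Ω → ℝ) (hw : ∀ σ, 0 < w σ) :
    ConvexOn ℝ Set.univ fun t : ℝ => Real.log (∑ σ, w σ * Real.exp (t * m σ)) := by
  refine ⟨convex_univ, fun x _ y _ s t hs ht hst => ?_⟩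
  have hpos : ∀ u : ℝ, 0 < ∑ σ, w σ * Real.exp (u * m σ) := fun u =>
    Finset.sum_pos (fun σ _ => mul_pos (hw σ) (Real.exp_pos _)) Finset.univ_nonempty
  set X := ∑ σ, w σ * Real.exp (x * m σ) with hX
  set Y := ∑ σ, w σ * Real.exp (y * m σ) with hY
  simp only [smul_eq_mul]
  rw [Real.log_le_iff_le_exp (hpos _)]
  -- Convexity of `exp` is applied to exponents shifted by `log X` and `log Y`, so that both
  -- exponential sums are normalized; this is Hölder's inequality.
  have key : ∀ σ, w σ * Real.exp ((s * x + t * y) * m σ) ≤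
      Real.exp (s * Real.log X + t * Real.log Y) *
        (s * (w σ * Real.exp (x * m σ) / X) + t * (w σ * Real.exp (y * m σ) / Y)) := by
    intro σ
    have h := convexOn_exp.2 (Set.mem_univ (x * m σ - Real.log X))
      (Set.mem_univ (y * m σ - Real.log Y)) hs ht hst
    simp only [smul_eq_mul] at h
    rw [Real.exp_sub, Real.exp_sub, Real.exp_log (hpos x), Real.exp_log (hpos y)] at h
    have e : (s * x + t * y) * m σ = (s * Real.log X + t * Real.log Y) +
        (s * (x * m σ - Real.log X) + t * (y * m σ - Real.log Y)) := by ring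
    rw [e, Real.exp_add]
    have h2 := mul_le_mul_of_nonneg_left h
      (mul_pos (hw σ) (Real.exp_pos (s * Real.log X + t * Real.log Y))).le
    refine le_trans (le_of_eq ?_) (h2.trans (le_of_eq ?_))
    · ring
    · ring
  refine (Finset.sum_le_sum fun σ _ => key σ).trans (le_of_eq ?_)
  rw [← Finset.mul_sum, Finset.sum_add_distrib, ← Finset.mul_sum, ← Finset.mul_sum,
    ← Finset.sum_div, ← Finset.sum_div, ← hX, ← hY, div_self (hpos x).ne', div_self (hpos y).ne',
    mul_one, mul_one, hst, mul_one]

/-- The symmetry `F` makes the sum even in `t`, so `exp |u| ≤ exp u + exp (-u)` costs only a factor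
2; Jensen's inequality then brings in the mean of `|m|`, which `m² ≤ B |m|` bounds below by `q / B`.
-/
lemma half_exp_le_sum_exp (w m : Ω → ℝ) (hw : ∀ σ, 0 < w σ) (F : Ω ≃ Ω)
    (hwF : ∀ σ, w (F σ) = w σ) (hmF : ∀ σ, m (F σ) = -m σ) {B q : ℝ} (hB : 0 < B)
    (hmB : ∀ σ, |m σ| ≤ B) (hZ : ∑ σ, w σ ≠ 0)
    (hq : q * ∑ σ, w σ ≤ ∑ σ, w σ * m σ ^ 2) (t : ℝ) :
    1 / 2 * Real.exp (|t| * (q / B)) * ∑ σ, w σ ≤ ∑ σ, w σ * Real.exp (t * m σ) := by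
  set Z := ∑ σ, w σ with hZdef
  have hZ0 : 0 < Z := lt_of_le_of_ne (Finset.sum_nonneg fun σ _ => (hw σ).le) hZ.symm
  have hflip : ∑ σ, w σ * Real.exp (-(t * m σ)) = ∑ σ, w σ * Real.exp (t * m σ) := by
    rw [← F.sum_comp fun σ => w σ * Real.exp (t * m σ)]
    refine Finset.sum_congr rfl fun σ _ => ?_
    rw [hwF, hmF, mul_neg]
  have h1 : ∑ σ, w σ * Real.exp (|t| * |m σ|) ≤ 2 * ∑ σ, w σ * Real.exp (t * m σ) := by
    rw [two_mul]
    nth_rw 2 [← hflip]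
    rw [← Finset.sum_add_distrib]
    refine Finset.sum_le_sum fun σ _ => ?_
    rw [← mul_add, ← abs_mul]
    refine mul_le_mul_of_nonneg_left ?_ (hw σ).le
    rcases abs_cases (t * m σ) with ⟨h, -⟩ | ⟨h, -⟩ <;> rw [h] <;>
      linarith [Real.exp_pos (t * m σ), Real.exp_pos (-(t * m σ))]
  have hJ := convexOn_exp.map_sum_le (t := Finset.univ) (w := fun σ => w σ / Z)
    (p := fun σ => |t| * |m σ|) (fun σ _ => (div_pos (hw σ) hZ0).le)
    (by rw [← Finset.sum_div, div_self hZ]) (fun _ _ => Set.mem_univ _)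
  simp only [smul_eq_mul] at hJ
  have h2 : |t| * (q / B) ≤ ∑ σ, w σ / Z * (|t| * |m σ|) := by
    have e : ∑ σ, w σ / Z * (|t| * |m σ|) = |t| * ((∑ σ, w σ * |m σ|) / Z) := by
      rw [Finset.sum_div, Finset.mul_sum]
      refine Finset.sum_congr rfl fun σ _ => ?_
      ring
    rw [e]
    refine mul_le_mul_of_nonneg_left ?_ (abs_nonneg t)
    rw [div_le_div_iff₀ hB hZ0]
    refine hq.trans ?_
    rw [Finset.sum_mul]
    refine Finset.sum_le_sum fun σ _ => ?_
    rw [mul_assoc, ← sq_abs, pow_two]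
    exact mul_le_mul_of_nonneg_left
      (mul_le_mul_of_nonneg_left (hmB σ) (abs_nonneg _)) (hw σ).le
  have h3 : Real.exp (|t| * (q / B)) * Z ≤ ∑ σ, w σ * Real.exp (|t| * |m σ|) := by
    have h4 := mul_le_mul_of_nonneg_right ((Real.exp_le_exp.mpr h2).trans hJ) hZ0.le
    refine h4.trans (le_of_eq ?_)
    rw [Finset.sum_mul]
    refine Finset.sum_congr rfl fun σ _ => ?_
    field_simp
  linarith

end Weights

/-! ### Conservation and reversal of the magnetization -/

section Magnetization

open scoped Matrix

variable {ι : Type*} [Fintype ι] [DecidableEq ι] {n : ℕ}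

/-- The eigenvalues of the third spin operator. -/
noncomputable def spinValue (n : ℕ) (k : Fin n) : ℝ := ((n : ℝ) - 1) / 2 - (k.val : ℝ)

lemma abs_spinValue_le (k : Fin n) : |spinValue n k| ≤ n := by
  have h1 : (k.val : ℝ) + 1 ≤ n := by exact_mod_cast k.isLt
  have h2 : (0 : ℝ) ≤ k.val := Nat.cast_nonneg _
  rw [spinValue, abs_le]
  constructor <;> linarith

lemma spinValue_rev (k : Fin n) : spinValue n k.rev = -spinValue n k := by
  have h1 : k.val + 1 ≤ n := k.isLt
  rw [spinValue, spinValue, Fin.val_rev, Nat.cast_sub h1]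
  push_cast
  ring

/-- The total third spin component of a configuration. -/
noncomputable def magnetization (σ : ι → Fin n) : ℝ := ∑ x, spinValue n (σ x)

omit [DecidableEq ι] in
lemma abs_magnetization_le (σ : ι → Fin n) : |magnetization σ| ≤ n * Fintype.card ι := by
  refine (Finset.abs_sum_le_sum_abs _ _).trans ?_
  refine (Finset.sum_le_card_nsmul _ _ _ fun x _ => abs_spinValue_le (σ x)).trans (le_of_eq ?_)
  rw [nsmul_eq_mul, mul_comm, Finset.card_univ]

lemma siteOp_spin_two (x : ι) :
    siteOp x (spin n 2) = Matrix.diagonal fun σ => (spinValue n (σ x) : ℂ) := by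
  ext σ τ
  have hs : spin n 2 = Matrix.diagonal fun k : Fin n => (spinValue n k : ℂ) := by
    simp [spin, spinValue]
  rw [hs, siteOp, Matrix.of_apply]
  by_cases h : σ = τ
  · subst h
    simp
  · rw [Matrix.diagonal_apply_ne _ h]
    split_ifs with h1
    · refine Matrix.diagonal_apply_ne _ fun h2 => h ?_
      funext y
      by_cases hy : y = x
      · rw [hy, h2]
      · exact h1 y hy
    · rfl

lemma sum_siteOp_spin_two :
    ∑ x : ι, siteOp x (spin n 2) = Matrix.diagonal fun σ => (magnetization σ : ℂ) := by
  ext σ τ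
  simp only [siteOp_spin_two, Matrix.sum_apply, Matrix.diagonal_apply, magnetization]
  split_ifs <;> simp

lemma pairHamiltonian_eq (c : Fin 3 → ι → ι → ℝ) (h : ℝ) :
    pairHamiltonian n c h = pairHamiltonian n c 0 -
      (h : ℂ) • Matrix.diagonal fun σ => (magnetization σ : ℂ) := by
  simp [pairHamiltonian, sum_siteOp_spin_two]

/-- A nonzero entry of the raising operator links configurations whose magnetizations differ by
exactly one. -/
lemma diagonal_mul_siteOp_raising (x : ι) :
    (Matrix.diagonal fun σ => (magnetization σ : ℂ)) * siteOp x (raising n) =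
      siteOp x (raising n) * (Matrix.diagonal fun σ => (magnetization σ : ℂ)) +
        siteOp x (raising n) := by
  ext σ τ
  rw [Matrix.diagonal_mul, Matrix.add_apply, Matrix.mul_diagonal]
  simp only [siteOp, raising, Matrix.of_apply]
  by_cases h1 : ∀ y, y ≠ x → σ y = τ y
  · by_cases h2 : (σ x).val + 1 = (τ x).val
    · have hm : magnetization σ = magnetization τ + 1 := by
        rw [magnetization, magnetization, ← sub_eq_iff_eq_add', ← Finset.sum_sub_distrib,
          Finset.sum_eq_single x]
        · rw [spinValue, spinValue, ← h2]
          push_cast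
          ring
        · intro y _ hy
          rw [h1 y hy, sub_self]
        · simp
      rw [if_pos h1, if_pos h2, hm]
      push_cast
      ring
    · rw [if_pos h1, if_neg h2]
      simp
  · rw [if_neg h1]
    simp

lemma diagonal_mul_siteOp_lowering (x : ι) :
    (Matrix.diagonal fun σ => (magnetization σ : ℂ)) * siteOp x (raising n)ᴴ =
      siteOp x (raising n)ᴴ * (Matrix.diagonal fun σ => (magnetization σ : ℂ)) -
        siteOp x (raising n)ᴴ := by
  have h := congrArg Matrix.conjTranspose (diagonal_mul_siteOp_raising (n := n) x)
  have hs : (siteOp x (raising n))ᴴ = siteOp x (raising n)ᴴ :=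
    (map_star (siteHom x) (raising n)).symm
  have hd : (Matrix.diagonal fun σ : ι → Fin n => (magnetization σ : ℂ))ᴴ =
      Matrix.diagonal fun σ => (magnetization σ : ℂ) := by
    rw [Matrix.diagonal_conjTranspose]
    congr 1
    funext σ
    simp
  rw [Matrix.conjTranspose_mul, Matrix.conjTranspose_add, Matrix.conjTranspose_mul, hs, hd] at h
  rw [h, add_sub_cancel_right]

lemma spin_mul_add_spin_mul (x y : ι) :
    siteOp x (spin n 0) * siteOp y (spin n 0) + siteOp x (spin n 1) * siteOp y (spin n 1) =
      (1 / 2 : ℂ) • (siteOp x (raising n) * siteOp y (raising n)ᴴ +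
        siteOp x (raising n)ᴴ * siteOp y (raising n)) := by
  have h0 : ∀ x : ι, siteOp x (spin n 0) =
      (1 / 2 : ℂ) • (siteOp x (raising n) + siteOp x (raising n)ᴴ) := fun x => by
    simp only [← siteHom_apply, ← map_add, ← map_smul]
    rfl
  have h1 : ∀ x : ι, siteOp x (spin n 1) =
      (-Complex.I / 2) • (siteOp x (raising n) - siteOp x (raising n)ᴴ) := fun x => by
    simp only [← siteHom_apply, ← map_sub, ← map_smul]
    rfl
  rw [h0, h0, h1, h1]
  simp only [Matrix.smul_mul, Matrix.mul_smul, add_mul, mul_add, sub_mul, mul_sub, smul_add,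
    smul_sub, smul_smul]
  have hI : -Complex.I / 2 * (-Complex.I / 2) = -(1 / 4) := by
    linear_combination (1 / 4) * Complex.I_mul_I
  rw [hI]
  module

/-- Each term of the exchange raises one spin and lowers another (or the same one), so the shifts of
the magnetization cancel. -/
lemma commute_diagonal_exchange (x y : ι) :
    Commute (Matrix.diagonal fun σ : ι → Fin n => (magnetization σ : ℂ))
      (siteOp x (spin n 0) * siteOp y (spin n 0) + siteOp x (spin n 1) * siteOp y (spin n 1)) := by
  rw [spin_mul_add_spin_mul]
  refine Commute.smul_right (Commute.add_right ?_ ?_) _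
  · rw [Commute, SemiconjBy, ← mul_assoc, diagonal_mul_siteOp_raising, add_mul, mul_assoc,
      diagonal_mul_siteOp_lowering, mul_sub, mul_assoc, sub_add_cancel]
  · rw [Commute, SemiconjBy, ← mul_assoc, diagonal_mul_siteOp_lowering, sub_mul, mul_assoc,
      diagonal_mul_siteOp_raising, mul_add, mul_assoc, add_sub_cancel_right]

/-- Equality of the first two couplings is essential: only then do the first two components combine
into exchange terms. -/
lemma commute_diagonal_pairHamiltonian {c : Fin 3 → ι → ι → ℝ} (hc : ∀ x y, c 0 x y = c 1 x y) :
    Commute (Matrix.diagonal fun σ : ι → Fin n => (magnetization σ : ℂ))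
      (pairHamiltonian n c 0) := by
  have e : pairHamiltonian n c 0 = -∑ x : ι, ∑ y : ι,
      ((c 1 x y : ℂ) • (siteOp x (spin n 0) * siteOp y (spin n 0) +
        siteOp x (spin n 1) * siteOp y (spin n 1)) +
      (c 2 x y : ℂ) • (siteOp x (spin n 2) * siteOp y (spin n 2))) := by
    simp only [pairHamiltonian, Complex.ofReal_zero, zero_smul, sub_zero, Fin.sum_univ_three,
      Finset.sum_add_distrib, smul_add, hc]
  rw [e]
  refine Commute.neg_right (Commute.sum_right _ _ _ fun x _ => Commute.sum_right _ _ _ fun y _ =>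
    Commute.add_right ((commute_diagonal_exchange x y).smul_right _) (Commute.smul_right ?_ _))
  rw [siteOp_spin_two, siteOp_spin_two, Matrix.diagonal_mul_diagonal, Commute, SemiconjBy,
    Matrix.diagonal_mul_diagonal, Matrix.diagonal_mul_diagonal]
  congr 1
  funext σ
  ring

/-- The weight of a configuration in zero field. -/
noncomputable def weight (n : ℕ) (c : Fin 3 → ι → ι → ℝ) (b : ℝ) (σ : ι → Fin n) : ℝ :=
  (NormedSpace.exp (-((b : ℂ) • pairHamiltonian n c 0)) σ σ).re

lemma weight_pos {c : Fin 3 → ι → ι → ℝ} (hc : ∀ i x y, c i x y = c i y x) (b : ℝ)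
    (σ : ι → Fin n) : 0 < weight n c b σ :=
  (exp_apply_self_pos (neg_smul_isHermitian (pairHamiltonian_isHermitian hc 0) b) σ).1

lemma exp_apply_self_eq_weight {c : Fin 3 → ι → ι → ℝ} (hc : ∀ i x y, c i x y = c i y x) (b : ℝ)
    (σ : ι → Fin n) :
    NormedSpace.exp (-((b : ℂ) • pairHamiltonian n c 0)) σ σ = (weight n c b σ : ℂ) := by
  refine Complex.ext (by simp [weight]) ?_
  rw [(exp_apply_self_pos (neg_smul_isHermitian (pairHamiltonian_isHermitian hc 0) b) σ).2,
    Complex.ofReal_im]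

/-- By commutation the exponential factorizes. The field factor is diagonal, so the trace sees only
the diagonal of the zero-field exponential. -/
lemma trace_exp_eq_sum_weight {c : Fin 3 → ι → ι → ℝ} (hc : ∀ i x y, c i x y = c i y x)
    (hc01 : ∀ x y, c 0 x y = c 1 x y) (b h : ℝ) :
    (NormedSpace.exp (-((b : ℂ) • pairHamiltonian n c h))).trace.re =
      ∑ σ, weight n c b σ * Real.exp (b * h * magnetization σ) := by
  have e : -((b : ℂ) • pairHamiltonian n c h) = -((b : ℂ) • pairHamiltonian n c 0) +
      Matrix.diagonal fun σ => ((b * h * magnetization σ : ℝ) : ℂ) := by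
    rw [pairHamiltonian_eq c h, smul_sub, neg_sub, sub_eq_neg_add, smul_smul,
      ← Matrix.diagonal_smul]
    congr 2
    funext σ
    simp
  have hd : (Matrix.diagonal fun σ : ι → Fin n => ((b * h * magnetization σ : ℝ) : ℂ)) =
      ((b * h : ℝ) : ℂ) • Matrix.diagonal fun σ => (magnetization σ : ℂ) := by
    rw [← Matrix.diagonal_smul]
    congr 1
    funext σ
    simp
  rw [e, Matrix.exp_add_of_commute]
  · rw [Matrix.exp_diagonal, Matrix.trace, Complex.re_sum]
    refine Finset.sum_congr rfl fun σ _ => ?_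
    rw [Matrix.diag_apply, Matrix.mul_diagonal, exp_apply_self_eq_weight hc, Pi.coe_exp,
      ← Complex.exp_eq_exp_ℂ, ← Complex.ofReal_exp, ← Complex.ofReal_mul, Complex.ofReal_re]
  · rw [hd]
    exact (((commute_diagonal_pairHamiltonian hc01).symm.smul_left _).neg_left).smul_right _

lemma trace_spin_mul_spin_mul_exp {c : Fin 3 → ι → ι → ℝ} (hc : ∀ i x y, c i x y = c i y x)
    (b : ℝ) :
    ∑ x, ∑ y, (siteOp x (spin n 2) * siteOp y (spin n 2) *
      NormedSpace.exp (-((b : ℂ) • pairHamiltonian n c 0))).trace =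
      ((∑ σ, weight n c b σ * magnetization σ ^ 2 : ℝ) : ℂ) := by
  have h1 : ∑ x : ι, ∑ y : ι, siteOp x (spin n 2) * siteOp y (spin n 2) =
      Matrix.diagonal fun σ => ((magnetization σ ^ 2 : ℝ) : ℂ) := by
    rw [← Finset.sum_mul_sum, sum_siteOp_spin_two, Matrix.diagonal_mul_diagonal]
    congr 1
    funext σ
    push_cast
    ring
  simp only [← Matrix.trace_sum, ← Finset.sum_mul]
  rw [h1, Matrix.trace, Complex.ofReal_sum]
  refine Finset.sum_congr rfl fun σ _ => ?_
  rw [Matrix.diag_apply, Matrix.diagonal_mul, exp_apply_self_eq_weight hc, ← Complex.ofReal_mul,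
    mul_comm]

/-- The rotation by `π` about the first axis, on configurations. -/
def flip (ι : Type*) (n : ℕ) : (ι → Fin n) ≃ (ι → Fin n) :=
  (Equiv.refl ι).arrowCongr Fin.revPerm

omit [Fintype ι] [DecidableEq ι] in
lemma flip_apply (σ : ι → Fin n) (x : ι) : flip ι n σ x = (σ x).rev := rfl

omit [Fintype ι] [DecidableEq ι] in
lemma flip_symm : (flip ι n).symm = flip ι n := rfl

omit [DecidableEq ι] in
lemma magnetization_flip (σ : ι → Fin n) : magnetization (flip ι n σ) = -magnetization σ := by
  simp only [magnetization, flip_apply, spinValue_rev, Finset.sum_neg_distrib]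

lemma reindex_flip_siteOp (x : ι) (A : Matrix (Fin n) (Fin n) ℂ) :
    Matrix.reindexAlgEquiv ℂ ℂ (flip ι n) (siteOp x A) =
      siteOp x (Matrix.reindex Fin.revPerm Fin.revPerm A) := by
  ext σ τ
  simp only [Matrix.coe_reindexAlgEquiv, Matrix.reindex_apply, Matrix.submatrix_apply, siteOp,
    Matrix.of_apply, flip_symm, flip_apply, Fin.rev_inj, Fin.revPerm_symm, Fin.revPerm_apply]

lemma reindex_rev_raising (n : ℕ) :
    Matrix.reindex Fin.revPerm Fin.revPerm (raising n) = (raising n)ᴴ := by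
  ext j k
  simp only [Matrix.reindex_apply, Matrix.submatrix_apply, Matrix.conjTranspose_apply, raising,
    Matrix.of_apply, Fin.revPerm_symm, Fin.revPerm_apply, Fin.val_rev]
  by_cases h : k.val + 1 = j.val
  · rw [if_pos h, if_pos (by omega), RCLike.star_def, Complex.conj_ofReal, ← h,
      Nat.cast_sub (by omega)]
    congr 2
    push_cast
    ring
  · rw [if_neg h, if_neg (by omega), star_zero]

/-- The first component is fixed and the other two change sign; the sign drops out of the products
in the zero-field Hamiltonian. -/
lemma reindex_rev_spin (n : ℕ) (i : Fin 3) :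
    Matrix.reindex Fin.revPerm Fin.revPerm (spin n i) = spin n i ∨
      Matrix.reindex Fin.revPerm Fin.revPerm (spin n i) = -spin n i := by
  have h1 := reindex_rev_raising n
  have h2 : Matrix.reindex Fin.revPerm Fin.revPerm (raising n)ᴴ = raising n := by
    rw [← h1]
    ext j k
    simp
  rw [Matrix.reindex_apply] at h1 h2
  fin_cases i
  · left
    simp only [spin, Fin.zero_eta, Matrix.cons_val_zero, Matrix.reindex_apply,
      Matrix.submatrix_smul, Matrix.submatrix_add, Pi.smul_apply, Pi.add_apply, h1, h2]
    rw [add_comm]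
  · right
    simp only [spin, Fin.mk_one, Matrix.cons_val_one, Matrix.cons_val_zero, Matrix.reindex_apply,
      Matrix.submatrix_smul, Matrix.submatrix_sub, Pi.smul_apply, Pi.sub_apply, h1, h2]
    rw [← smul_neg, neg_sub]
  · right
    have hs : spin n 2 = Matrix.diagonal fun k : Fin n => (spinValue n k : ℂ) := by
      simp [spin, spinValue]
    simp only [Fin.reduceFinMk, hs, Matrix.reindex_apply]
    rw [Matrix.submatrix_diagonal_equiv, Matrix.diagonal_neg]
    congr 1
    funext k
    simp [spinValue_rev]

lemma reindex_flip_pairHamiltonian (c : Fin 3 → ι → ι → ℝ) :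
    Matrix.reindexAlgEquiv ℂ ℂ (flip ι n) (pairHamiltonian n c 0) = pairHamiltonian n c 0 := by
  simp only [pairHamiltonian, map_neg, map_sum, map_smul, map_mul, Complex.ofReal_zero,
    zero_smul, sub_zero]
  refine congrArg Neg.neg ?_
  refine Finset.sum_congr rfl fun i _ => Finset.sum_congr rfl fun x _ =>
    Finset.sum_congr rfl fun y _ => ?_
  rw [reindex_flip_siteOp, reindex_flip_siteOp]
  rcases reindex_rev_spin n i with h | h
  · rw [h]
  · rw [h]
    simp only [← siteHom_apply, map_neg, neg_mul_neg]

lemma weight_flip (c : Fin 3 → ι → ι → ℝ) (b : ℝ) (σ : ι → Fin n) :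
    weight n c b (flip ι n σ) = weight n c b σ := by
  have h : Matrix.reindexAlgEquiv ℂ ℂ (flip ι n) (-((b : ℂ) • pairHamiltonian n c 0)) =
      -((b : ℂ) • pairHamiltonian n c 0) := by
    rw [map_neg, map_smul, reindex_flip_pairHamiltonian]
  unfold weight
  conv_rhs => rw [← h, Matrix.coe_reindexAlgEquiv, exp_reindex]
  rw [Matrix.reindex_apply, Matrix.submatrix_apply, flip_symm]

lemma logPartition_convexOn [NeZero n] {c : Fin 3 → ι → ι → ℝ} (hc : ∀ i x y, c i x y = c i y x)
    (hc01 : ∀ x y, c 0 x y = c 1 x y) (b : ℝ) :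
    ConvexOn ℝ Set.univ (logPartition n c b) := by
  have h := log_sum_exp_convexOn (weight n c b) (fun σ => b * magnetization σ) (weight_pos hc b)
  have e : logPartition n c b = fun t =>
      Real.log (∑ σ, weight n c b σ * Real.exp (t * (b * magnetization σ))) := by
    funext t
    rw [logPartition, trace_exp_eq_sum_weight hc hc01]
    congr 1
    refine Finset.sum_congr rfl fun σ _ => ?_
    ring_nf
  rw [e]
  exact h

lemma le_logPartition [NeZero n] [Nonempty ι] {c : Fin 3 → ι → ι → ℝ}
    (hc : ∀ i x y, c i x y = c i y x) (hc01 : ∀ x y, c 0 x y = c 1 x y) {b q : ℝ} (hb : 0 ≤ b)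
    (hq : q * ∑ σ, weight n c b σ ≤ ∑ σ, weight n c b σ * magnetization σ ^ 2) (h : ℝ) :
    logPartition n c b 0 - Real.log 2 + b * |h| * (q / (n * Fintype.card ι)) ≤
      logPartition n c b h := by
  have hn : (0 : ℝ) < n := by exact_mod_cast NeZero.pos n
  have hι : (0 : ℝ) < Fintype.card ι := by exact_mod_cast Fintype.card_pos
  have hZ : 0 < ∑ σ, weight n c b σ :=
    Finset.sum_pos (fun σ _ => weight_pos hc b σ) Finset.univ_nonempty
  have h1 := half_exp_le_sum_exp (weight n c b) magnetization (weight_pos hc b) (flip ι n)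
    (weight_flip c b) magnetization_flip (mul_pos hn hι) abs_magnetization_le hZ.ne' hq (b * h)
  rw [← trace_exp_eq_sum_weight hc hc01] at h1
  have h2 := Real.log_le_log (by positivity) h1
  rw [Real.log_mul (by positivity) hZ.ne', Real.log_mul (by norm_num) (Real.exp_pos _).ne',
    Real.log_exp, one_div, Real.log_inv, abs_mul, abs_of_nonneg hb] at h2
  have h3 : logPartition n c b 0 = Real.log (∑ σ, weight n c b σ) := by
    rw [logPartition, trace_exp_eq_sum_weight hc hc01]
    simp
  rw [h3, logPartition]
  linarith

end Magnetization

/-! ### Finite-volume estimates for the pressure, and convex functions with a kink -/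

section FreeEnergy

variable {d n : ℕ} {J : Fin 3 → (Fin d → ℤ) → ℝ}

lemma pressure_convexOn [NeZero n] (hsymm : ∀ i x, J i (-x) = J i x) (hJ : ∀ x, J 0 x = J 1 x)
    {b : ℝ} (hb : 0 < b) (Λ : Finset (Fin d → ℤ)) :
    ConvexOn ℝ Set.univ fun h => pressure n J b h Λ := by
  have h := logPartition_convexOn (n := n) (c := fun i (x y : Λ) => J i (x.val - y.val))
    (fun i x y => coupling_symm hsymm i _ _) (fun x y => hJ _) b
  exact h.smul (one_div_pos.mpr hb).le

lemma pressure_eq_freeEnergyReal [NeZero n] (hsymm : ∀ i x, J i (-x) = J i x) {b : ℝ}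
    (hb : 0 < b) (h : ℝ) (Λ : Finset (Fin d → ℤ)) :
    pressure n J b h Λ = -(Λ.card * freeEnergyReal n J Λ b h) := by
  rcases Λ.eq_empty_or_nonempty with rfl | hΛ
  · rw [(pressure_almostAdditive hsymm hb h).empty]
    simp
  · have hN : (Λ.card : ℝ) ≠ 0 := by exact_mod_cast hΛ.card_pos.ne'
    unfold pressure freeEnergyReal
    field_simp

/-- Every `0 < β ≤ ∞` is described by a filter of finite inverse temperatures bounded away
from zero. -/
lemma exists_inverseTemperature_filter [NeZero n] (hsymm : ∀ i x, J i (-x) = J i x) {β : ℝ≥0∞}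
    (hβ : 0 < β) :
    ∃ l : Filter ℝ, l.NeBot ∧ (∃ b₀ : ℝ, 0 < b₀ ∧ ∀ᶠ b in l, b₀ ≤ b) ∧
      (∀ (Λ : Finset (Fin d → ℤ)) (h : ℝ), Tendsto (fun b => freeEnergyReal n J Λ b h) l
        (𝓝 (freeEnergy n J Λ β h))) ∧
      ∀ (Λ : Finset (Fin d → ℤ)) (h : ℝ) (A : Matrix (Λ → Fin n) (Λ → Fin n) ℂ),
        Tendsto (fun b => stateReal n J Λ b h A) l (𝓝 (state n J Λ β h A)) := by
  by_cases hβt : β = ∞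
  · have hneg : ∀ (Λ : Finset (Fin d → ℤ)) (b h : ℝ), gibbs n J Λ b h =
        NormedSpace.exp ((b : ℂ) • -hamiltonian n J Λ h) := fun Λ b h => by
      rw [gibbs, smul_neg]
    have hherm : ∀ (Λ : Finset (Fin d → ℤ)) (h : ℝ), (-hamiltonian n J Λ h).IsHermitian :=
      fun Λ h => (pairHamiltonian_isHermitian (n := n)
        (c := fun i (x y : Λ) => J i (x.val - y.val))
        (fun i x y => coupling_symm hsymm i _ _) h).neg
    refine ⟨atTop, inferInstance, ⟨1, one_pos, eventually_ge_atTop 1⟩, fun Λ h => ?_,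
      fun Λ h A => ?_⟩
    · rw [freeEnergy, if_pos hβt]
      obtain ⟨L, hL⟩ := exists_tendsto_log_trace (hherm Λ h)
      -- `limUnder` is a junk value unless the limit exists, so existence has to be supplied.
      refine tendsto_nhds_limUnder ⟨-(1 / (Λ.card : ℝ)) * L, ?_⟩
      refine (hL.const_mul (-(1 / (Λ.card : ℝ)))).congr fun b => ?_
      rw [freeEnergyReal, partitionFunction, hneg]
      rw [← one_div_mul_one_div]
      ring
    · rw [state, if_pos hβt]
      obtain ⟨L, hL⟩ := exists_tendsto_trace_div (hherm Λ h) A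
      refine tendsto_nhds_limUnder ⟨L, hL.congr fun b => ?_⟩
      rw [stateReal, partitionFunction, hneg]
  · refine ⟨pure β.toReal, inferInstance, ⟨β.toReal, ENNReal.toReal_pos hβ.ne' hβt, ?_⟩,
      fun Λ h => ?_, fun Λ h A => ?_⟩
    · exact eventually_pure.mpr le_rfl
    · rw [freeEnergy, if_neg hβt]
      exact tendsto_pure_nhds _ _
    · rw [state, if_neg hβt]
      exact tendsto_pure_nhds _ _

lemma sum_stateReal (hsymm : ∀ i x, J i (-x) = J i x) (hJ : ∀ x, J 0 x = J 1 x)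
    (Λ : Finset (Fin d → ℤ)) (b : ℝ) :
    ∑ x : Λ, ∑ y : Λ, (stateReal n J Λ b 0 (spinAt n Λ 2 x * spinAt n Λ 2 y)).re =
      (∑ σ, weight n (fun i (x y : Λ) => J i (x.val - y.val)) b σ * magnetization σ ^ 2) /
        ∑ σ, weight n (fun i (x y : Λ) => J i (x.val - y.val)) b σ := by
  set c : Fin 3 → Λ → Λ → ℝ := fun i x y => J i (x.val - y.val)
  have hc : ∀ i x y, c i x y = c i y x := fun i x y => coupling_symm hsymm i _ _
  have h1 := trace_spin_mul_spin_mul_exp (n := n) hc b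
  have h2 := trace_exp_eq_sum_weight (n := n) hc (fun x y => hJ _) b 0
  simp only [mul_zero, zero_mul, Real.exp_zero, mul_one] at h2
  have h3 : partitionFunction n J Λ b 0 = ∑ σ, weight n c b σ := h2
  simp only [stateReal, h3, ← Complex.re_sum, ← Finset.sum_div]
  have h4 : ∑ x : Λ, ∑ y : Λ, (spinAt n Λ 2 x * spinAt n Λ 2 y * gibbs n J Λ b 0).trace =
      ((∑ σ, weight n c b σ * magnetization σ ^ 2 : ℝ) : ℂ) := h1
  rw [h4, ← Complex.ofReal_div, Complex.ofReal_re]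

/-- The second moment is at least `a |Λ|²` and `|M| ≤ n |Λ|`, so the quotient in the exponent is `a
|Λ| / n`, of the order of the volume. -/
lemma le_pressure [NeZero n] (hsymm : ∀ i x, J i (-x) = J i x) (hJ : ∀ x, J 0 x = J 1 x)
    {Λ : Finset (Fin d → ℤ)} (hΛ : Λ.Nonempty) {b a : ℝ} (hb : 0 < b)
    (ha : a * (Λ.card : ℝ) ^ 2 ≤
      ∑ x : Λ, ∑ y : Λ, (stateReal n J Λ b 0 (spinAt n Λ 2 x * spinAt n Λ 2 y)).re) (h : ℝ) :
    pressure n J b 0 Λ - Real.log 2 / b + |h| * (a / n) * Λ.card ≤ pressure n J b h Λ := by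
  have : Nonempty Λ := hΛ.coe_sort
  have hN : (0 : ℝ) < Λ.card := by exact_mod_cast hΛ.card_pos
  have hn : (0 : ℝ) < n := by exact_mod_cast NeZero.pos n
  have hc : ∀ (i : Fin 3) (x y : Λ), J i (x.val - y.val) = J i (y.val - x.val) :=
    fun i x y => coupling_symm hsymm i _ _
  have hZ : 0 < ∑ σ, weight n (fun i (x y : Λ) => J i (x.val - y.val)) b σ :=
    Finset.sum_pos (fun σ _ => weight_pos hc b σ) Finset.univ_nonempty
  rw [sum_stateReal hsymm hJ, le_div_iff₀ hZ] at ha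
  have h1 := le_logPartition (n := n) hc (fun x y => hJ _) hb.le ha h
  rw [Fintype.card_coe] at h1
  have h2 := mul_le_mul_of_nonneg_left h1 (one_div_pos.mpr hb).le
  unfold pressure
  rw [log_partitionFunction, log_partitionFunction]
  refine le_trans (le_of_eq ?_) h2
  field_simp

/-- Convexity provides the one-sided derivatives; the cone bound keeps the slopes at or below `-a`
on the left and at or above `a` on the right. -/
lemma exists_oneSided_derivatives {p : ℝ → ℝ} (hp : ConvexOn ℝ Set.univ p) {a : ℝ} (ha : 0 < a)
    (hpa : ∀ h, p 0 + a * |h| ≤ p h) :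
    ∃ pLeft pRight : ℝ, HasDerivWithinAt p pLeft (Set.Iio 0) 0 ∧
      HasDerivWithinAt p pRight (Set.Ioi 0) 0 ∧ pLeft < 0 ∧ 0 < pRight := by
  have h0 : (0 : ℝ) ∈ interior Set.univ := by simp
  have hl := hp.hasDerivWithinAt_leftDeriv_of_mem_interior h0
  have hr := hp.hasDerivWithinAt_rightDeriv_of_mem_interior h0
  refine ⟨_, _, hl, hr, ?_, ?_⟩
  · rw [hasDerivWithinAt_iff_tendsto_slope' (by simp)] at hl
    refine lt_of_le_of_lt (le_of_tendsto hl ?_) (neg_neg_of_pos ha)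
    filter_upwards [self_mem_nhdsWithin] with y hy
    have hy' : y < 0 := hy
    have h1 := hpa y
    rw [abs_of_neg hy'] at h1
    rw [slope_def_field, sub_zero, div_le_iff_of_neg hy']
    linarith
  · rw [hasDerivWithinAt_iff_tendsto_slope' (by simp)] at hr
    refine lt_of_lt_of_le ha (ge_of_tendsto hr ?_)
    filter_upwards [self_mem_nhdsWithin] with y hy
    have hy' : 0 < y := hy
    have h1 := hpa y
    rw [abs_of_pos hy'] at h1
    rw [slope_def_field, sub_zero, le_div_iff₀ hy']
    linarith

end FreeEnergy

end QuantumSpin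

/-! ### Passage to the limits in temperature and volume -/

open QuantumSpin in
theorem theorem2p2 (d : ℕ) (hd : 1 ≤ d) (n : ℕ) (hn : 2 ≤ n)
    (J : Fin 3 → (Fin d → ℤ) → ℝ)
    (hsymm : ∀ i x, J i (-x) = J i x)
    (hsum : ∀ i, Summable fun x => |J i x|)
    (hJ : ∀ x, J 0 x = J 1 x)
    (β : ℝ≥0∞) (hβ : 0 < β)
    (hLRO : QuantumSpin.LongRangeOrder n J β) :
    ∃ f : ℝ → ℝ, QuantumSpin.IsInfiniteVolumeFreeEnergy n J β f ∧
      ∃ fLeft fRight : ℝ,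
        HasDerivWithinAt f fLeft (Set.Iio 0) 0 ∧
        HasDerivWithinAt f fRight (Set.Ioi 0) 0 ∧
        fLeft > 0 ∧ 0 > fRight := by
  have : NeZero n := ⟨by omega⟩
  have hn0 : (0 : ℝ) < n := by exact_mod_cast NeZero.pos n
  obtain ⟨l, hl, ⟨b₀, hb₀, hb₀l⟩, hF, hS⟩ :=
    exists_inverseTemperature_filter (d := d) (n := n) (J := J) hsymm hβ
  obtain ⟨Λ₀, hΛ₀, c, hc, hcΛ⟩ := hLRO
  set P : ℝ → Finset (Fin d → ℤ) → ℝ := fun h Λ => -(Λ.card * freeEnergy n J Λ β h) with hP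
  have hlim : ∀ h Λ, Tendsto (fun b => pressure n J b h Λ) l (𝓝 (P h Λ)) := by
    intro h Λ
    refine (((hF Λ h).const_mul (Λ.card : ℝ)).neg).congr' ?_
    filter_upwards [hb₀l] with b hb
    rw [pressure_eq_freeEnergyReal hsymm (hb₀.trans_le hb)]
  have hadd : ∀ h, AlmostAdditive (pairBound n J) (P h) := by
    intro h
    constructor
    · intro A B hAB
      refine le_of_tendsto (((hlim h (A ∪ B)).sub (hlim h A)).sub (hlim h B)).abs ?_
      filter_upwards [hb₀l] with b hb
      exact (pressure_almostAdditive hsymm (hb₀.trans_le hb) h).union A B hAB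
    · intro A v
      refine tendsto_nhds_unique_of_eventuallyEq (hlim h _) (hlim h _) ?_
      filter_upwards [hb₀l] with b hb
      exact (pressure_almostAdditive hsymm (hb₀.trans_le hb) h).translate A v
  have hex := fun h => (hadd h).exists_limit (fun z => pairBound_nonneg n z)
    (pairBound_summable n hsum) hΛ₀
  choose p hp using hex
  have hconv : ConvexOn ℝ Set.univ p := by
    refine ⟨convex_univ, fun x _ y _ s t hs ht hst => ?_⟩
    refine le_of_tendsto_of_tendsto' (hp _ Λ₀ hΛ₀)
      (((hp x Λ₀ hΛ₀).const_smul s).add ((hp y Λ₀ hΛ₀).const_smul t)) fun k => ?_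
    have h1 : P (s • x + t • y) (Λ₀ k) ≤ s • P x (Λ₀ k) + t • P y (Λ₀ k) := by
      refine le_of_tendsto_of_tendsto (hlim _ _)
        (((hlim x _).const_smul s).add ((hlim y _).const_smul t)) ?_
      filter_upwards [hb₀l] with b hb
      exact (pressure_convexOn hsymm hJ (hb₀.trans_le hb) (Λ₀ k)).2 (Set.mem_univ x)
        (Set.mem_univ y) hs ht hst
    simp only [smul_eq_mul] at h1 ⊢
    rw [← mul_div_assoc, ← mul_div_assoc, ← add_div]
    exact div_le_div_of_nonneg_right h1 (Nat.cast_nonneg _)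
  -- At `β = ∞` the correlations are only limits of those at finite `b`. Halving `c` leaves room for
  -- the order bound to hold eventually along `l`.
  have hfin : ∀ k h, P 0 (Λ₀ k) - Real.log 2 / b₀ + |h| * (c / 2 / n) * (Λ₀ k).card ≤
      P h (Λ₀ k) := by
    intro k h
    -- On an empty domain the long-range order bound would read `c ≤ 0`.
    have hne : (Λ₀ k).Nonempty := by
      rw [Finset.nonempty_iff_ne_empty]
      intro h0
      have h1 := hcΛ k
      rw [h0, Finset.card_empty] at h1
      norm_num at h1
      linarith
    have hN : (0 : ℝ) < (Λ₀ k).card := by exact_mod_cast hne.card_pos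
    have hstate : Tendsto (fun b => ∑ x : Λ₀ k, ∑ y : Λ₀ k,
        (stateReal n J (Λ₀ k) b 0 (spinAt n (Λ₀ k) 2 x * spinAt n (Λ₀ k) 2 y)).re) l
        (𝓝 (∑ x : Λ₀ k, ∑ y : Λ₀ k,
          (state n J (Λ₀ k) β 0 (spinAt n (Λ₀ k) 2 x * spinAt n (Λ₀ k) 2 y)).re)) :=
      tendsto_finsetSum _ fun x _ => tendsto_finsetSum _ fun y _ =>
        (Complex.continuous_re.tendsto _).comp (hS _ _ _)
    have hlt : c / 2 * ((Λ₀ k).card : ℝ) ^ 2 < ∑ x : Λ₀ k, ∑ y : Λ₀ k,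
        (state n J (Λ₀ k) β 0 (spinAt n (Λ₀ k) 2 x * spinAt n (Λ₀ k) 2 y)).re := by
      have h1 := hcΛ k
      rw [one_div, inv_mul_eq_div, le_div_iff₀ (by positivity)] at h1
      have h2 : 0 < c * ((Λ₀ k).card : ℝ) ^ 2 := by positivity
      linarith
    refine le_of_tendsto_of_tendsto (((hlim 0 (Λ₀ k)).sub_const (Real.log 2 / b₀)).add_const
      (|h| * (c / 2 / n) * (Λ₀ k).card)) (hlim h (Λ₀ k)) ?_
    filter_upwards [hb₀l, hstate.eventually (lt_mem_nhds hlt)] with b hb hb2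
    have h3 := le_pressure hsymm hJ hne (hb₀.trans_le hb) hb2.le h
    have h4 : Real.log 2 / b ≤ Real.log 2 / b₀ :=
      div_le_div_of_nonneg_left (Real.log_nonneg (by norm_num)) hb₀ hb
    linarith
  have hbound : ∀ h, p 0 + c / 2 / n * |h| ≤ p h := by
    intro h
    -- Per site, the loss `log 2 / b₀` vanishes because the volume diverges.
    have h1 := (tendsto_inv_atTop_zero.comp (hΛ₀.tendsto_card hd)).const_mul (Real.log 2 / b₀)
    have h2 := ((hp 0 Λ₀ hΛ₀).sub h1).add_const (c / 2 / n * |h|)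
    rw [mul_zero, sub_zero] at h2
    refine le_of_tendsto_of_tendsto h2 (hp h Λ₀ hΛ₀) ?_
    filter_upwards [hΛ₀.eventually_nonempty] with k hk
    have hN : (0 : ℝ) < (Λ₀ k).card := by exact_mod_cast hk.card_pos
    refine le_trans (le_of_eq ?_) (div_le_div_of_nonneg_right (hfin k h) hN.le)
    simp only [Function.comp_apply]
    field_simp
  obtain ⟨pLeft, pRight, hpl, hpr, hneg, hpos⟩ :=
    exists_oneSided_derivatives hconv (by positivity) hbound
  refine ⟨fun h => -p h, fun Λ hΛ h => ?_, -pLeft, -pRight, hpl.neg, hpr.neg, by linarith,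
    by linarith⟩
  refine ((hp h Λ hΛ).neg).congr' ?_
  filter_upwards [hΛ.eventually_nonempty] with k hk
  have hN : ((Λ k).card : ℝ) ≠ 0 := by exact_mod_cast hk.card_pos.ne'
  simp only [hP]
  field_simp
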